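/- Let $r$ be a positive divisor of $24$; write $\mathbf e(x)=e^{2\pi i x}$, $\zeta_n=\mathbf e(1/n)$, $q^{\alpha}=\mathbf e(\alpha\tau)$ for $\tau$ in the upper half plane $\mathbb H$, $T=\begin{pmatrix}1&1\\0&1\end{pmatrix}$, $S=\begin{pmatrix}0&-1\\1&0\end{pmatrix}$, $B=ST^2S^{-1}$. *Weil representation.* Let $L_r$ be the lattice of integral matrices $\begin{pmatrix}\lambda_{00}&\lambda_{01}\\2\lambda_{10}&\lambda_{11}\end{pmatrix}$ with quadratic form $Q_r=r\det$, $L_r'$ its dual, and $\mathcal A_r=L_r'/L_r$, identified with $\mathbb Z/r\times(\mathbb Z/2r)^2\times\mathbb Z/r$ by sending the class of $\frac1r\begin{pmatrix}h_0&h_1/2\\h_2&h_3\end{pmatrix}$ to $[h_0,h_1,h_2,h_3]$, so that $Q_r(h)=\frac{2h_0h_3-h_1h_2}{2r}\in\frac1{2r}\mathbb Z/\mathbb Z$. Let $(\cdot,\cdot)$ be the associated bilinear form and $U_r=\mathbb C[\mathcal A_r]$ with basis $\{\mathfrak e_h\}$. The Weil representation $\omega_r$ of $\mathrm{SL}_2(\mathbb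 Z)$ on $U_r$ is given by $\omega_r(T)\mathfrak e_h=\mathbf e(-Q_r(h))\mathfrak e_h$ and $\omega_r(S)\mathfrak e_h=|\mathcal A_r|^{-1/2}\sum_{\mu}\mathbf e((\mu,h))\mathfrak e_\mu$. *Group $H'_r$.* The group $\Gamma_0(2)\times\Gamma_0(2)$ acts on $\mathcal A_r$ by $(g_1,g_2)\cdot X=g_1Xg_2^{-1}$, hence on $U_r$ by $\mathfrak e_h\mapsto\mathfrak e_{(g_1,g_2)\cdot h}$. Let $\Gamma_{\chi,r}\subset\Gamma_0(2)$ be the subgroup generated by the derived subgroup of $\Gamma_0(2)$ and $T^{24},S^2,TB,T^r$, and let $H'_r$ be the group of automorphisms of $\mathcal A_r$ given by the elements of the subgroup of $\Gamma_0(2)\times\Gamma_0(2)$ generated by $(T,T)$ and $\Gamma_{\chi,r}\times\Gamma_{\chi,r}$. *Vectors.* For $g\in\Gamma_0(2)$ let $\kappa_r(g)=\frac1r g+L_r\in\mathcal A_r$. Put $$u_r=\sum_{j\in\mathbb Z/r}\Big(\sum_{s\in(\mathbb Z/r)^\times}\zeta_r^{sj}\Big)\sum_{h\in\kappa_r(T^j\Gamma_{\chi,r})}\mathfrak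 e_h,\qquad v_r=\omega_r(S)u_r,\qquad w_r=\zeta_{2r}^{-1}\omega_r(T)v_r .$$ *Three-dimensional representation and Weber functions.* Let $\varrho_r:\mathrm{SL}_2(\mathbb Z)\to\mathrm{GL}_3(\mathbb C)$ be the representation with $$\varrho_r(T)=\begin{pmatrix}\zeta_r^{-1}&0&0\\0&0&\zeta_{2r}\\0&\zeta_{2r}&0\end{pmatrix},\qquad \varrho_r(S)=\begin{pmatrix}0&1&0\\1&0&0\\0&0&1\end{pmatrix}.$$ Let $\mathfrak f(\tau)=\zeta_{48}^{-1}\eta(\frac{\tau+1}2)/\eta(\tau)$, $\mathfrak f_1(\tau)=\eta(\frac\tau2)/\eta(\tau)$, $\mathfrak f_2(\tau)=\sqrt2\,\eta(2\tau)/\eta(\tau)$, where $\eta$ is the Dedekind eta function, and let $$F_r=\sqrt2^{\,24/r}\begin{pmatrix}\mathfrak f_2^{-24/r}\\ \mathfrak f_1^{-24/r}\\ \mathfrak f^{-24/r}\end{pmatrix}.$$ For a finite-dimensional representation $\rho$ of $\mathrm{SL}_2(\mathbb Z)$ on $V$, let $M^!(\rho)$ be the space of weakly holomorphic modular functions for $\rho$: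 holomorphic $f:\mathbb H\to V$ with $f(\gamma\tau)=\rho(\gamma)f(\tau)$ for all $\gamma\in\mathrm{SL}_2(\mathbb Z)$ that are meromorphic at the cusp. **Proposition.** The linear map $\iota_r:\mathbb C^3\to U_r$, $(a,b,c)\mapsto a\,u_r+b\,v_r+c\,w_r$, is injective, takes values in the $H'_r$-invariants $U_r^{H'_r}$, and satisfies $\iota_r(\varrho_r(\gamma)x)=\omega_r(\gamma)\iota_r(x)$ for all $\gamma\in\mathrm{SL}_2(\mathbb Z)$, $x\in\mathbb C^3$; thus it embeds $\varrho_r$ into $\omega_r$. The function $\iota_r\circ F_r$ belongs to $M^!(\omega_r)$, its values are $H'_r$-invariant, and as $\mathrm{Im}\,\tau\to\infty$ $$\iota_r\circ F_r(\tau)=q^{-1/r}u_r+\begin{cases}O(q^{1/(2r)}),&r>1,\\ O(1),&r=1.\end{cases}$$ -/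

import Mathlib

open scoped MatrixGroups Manifold Asymptotics
open UpperHalfPlane

noncomputable section

namespace WeberWeil

/-! ### Representations of `SL(2, ℤ)` given by the images of `S` and `T` -/

section Presentation

open ModularGroup

theorem word_form {P : Type*} [Group P] (σ u z : P) (hz : σ * σ = z) (h4 : z * z = 1)
    (h3 : u * (u * u) = z) (x : P) (hx : x ∈ Subgroup.closure {σ, u}) :
    ∃ (e i j : ℕ) (l : List Bool), i < 3 ∧ j < 2 ∧
      x = z ^ e * (u ^ i * ((l.map fun b => if b then σ * u else σ * (u * u)).prod * σ ^ j)) := by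
  have hz1 : Commute σ z := by rw [← hz]; exact (Commute.refl σ).mul_right (Commute.refl σ)
  have hz2 : Commute u z := by
    rw [← h3]; exact (Commute.refl u).mul_right ((Commute.refl u).mul_right (Commute.refl u))
  have hzz : ∀ (e : ℕ) (Z : P), σ * (z ^ e * Z) = z ^ e * (σ * Z) := fun e Z => by
    rw [← mul_assoc, (hz1.pow_right e).eq, mul_assoc]
  have hzu : ∀ (e : ℕ) (Z : P), u * (z ^ e * Z) = z ^ e * (u * Z) := fun e Z => by
    rw [← mul_assoc, (hz2.pow_right e).eq, mul_assoc]
  have hσσ : ∀ Z : P, σ * (σ * Z) = z * Z := fun Z => by rw [← mul_assoc, hz]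
  have huuu : ∀ Z : P, u * (u * (u * Z)) = z * Z := fun Z => by
    rw [← h3]; simp only [mul_assoc]
  have hu : ∀ y : P, (∃ (e i j : ℕ) (l : List Bool), i < 3 ∧ j < 2 ∧
      y = z ^ e * (u ^ i * ((l.map fun b => if b then σ * u else σ * (u * u)).prod * σ ^ j))) →
      ∃ (e i j : ℕ) (l : List Bool), i < 3 ∧ j < 2 ∧
      u * y = z ^ e * (u ^ i * ((l.map fun b => if b then σ * u else σ * (u * u)).prod * σ ^ j)) := by
    rintro y ⟨e, i, j, l, hi, hj, rfl⟩
    interval_cases i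
    · exact ⟨e, 1, j, l, by norm_num, hj, by simp [hzu]⟩
    · exact ⟨e, 2, j, l, by norm_num, hj, by simp [hzu, pow_succ, mul_assoc]⟩
    · exact ⟨e + 1, 0, j, l, by norm_num, hj, by simp [hzu, pow_succ, mul_assoc, huuu]⟩
  have hs : ∀ y : P, (∃ (e i j : ℕ) (l : List Bool), i < 3 ∧ j < 2 ∧
      y = z ^ e * (u ^ i * ((l.map fun b => if b then σ * u else σ * (u * u)).prod * σ ^ j))) →
      ∃ (e i j : ℕ) (l : List Bool), i < 3 ∧ j < 2 ∧
      σ * y = z ^ e * (u ^ i * ((l.map fun b => if b then σ * u else σ * (u * u)).prod * σ ^ j)) := by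
    rintro y ⟨e, i, j, l, hi, hj, rfl⟩
    interval_cases i
    · rcases l with _ | ⟨b, l⟩
      · interval_cases j
        · exact ⟨e, 0, 1, [], by norm_num, by norm_num, by simp [(hz1.pow_right e).eq]⟩
        · exact ⟨e + 1, 0, 0, [], by norm_num, by norm_num, by simp [hzz, pow_succ, hz]⟩
      · cases b
        · exact ⟨e + 1, 2, j, l, by norm_num, hj, by simp [hzz, pow_succ, mul_assoc, hσσ]⟩
        · exact ⟨e + 1, 1, j, l, by norm_num, hj, by simp [hzz, pow_succ, mul_assoc, hσσ]⟩
    · exact ⟨e, 0, j, true :: l, by norm_num, hj, by simp [hzz, mul_assoc]⟩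
    · exact ⟨e, 0, j, false :: l, by norm_num, hj, by simp [hzz, pow_succ, mul_assoc]⟩
  have hu6 : u⁻¹ = u * (u * (u * (u * u))) := by
    rw [inv_eq_iff_mul_eq_one, huuu, h3, h4]
  have hs3 : σ⁻¹ = σ * (σ * σ) := by
    rw [inv_eq_iff_mul_eq_one, hσσ, hz, h4]
  induction hx using Subgroup.closure_induction_left with
  | one => exact ⟨0, 0, 0, [], by norm_num, by norm_num, by simp⟩
  | mul_left a ha y hy ih =>
    rcases ha with rfl | rfl
    · exact hs _ ih
    · exact hu _ ih
  | inv_mul_cancel a ha y hy ih =>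
    rcases ha with rfl | rfl
    · have := hs _ (hs _ (hs _ ih))
      rwa [hs3, mul_assoc, mul_assoc]
    · have := hu _ (hu _ (hu _ (hu _ (hu _ ih))))
      rwa [hu6, mul_assoc, mul_assoc, mul_assoc, mul_assoc]

theorem word_matrix (l : List Bool) : ∃ (a b c d ε : ℤ), 1 ≤ a ∧ 0 ≤ b ∧ 0 ≤ c ∧ 1 ≤ d ∧
    (l.length : ℤ) ≤ b + c ∧ ε * ε = 1 ∧
    (((l.map fun b => if b then S * (S * T) else S * (S * T * (S * T))).prod : SL(2, ℤ)) :
      Matrix (Fin 2) (Fin 2) ℤ) = !![ε * a, ε * b; ε * c, ε * d] := by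
  induction l with
  | nil => exact ⟨1, 0, 0, 1, 1, by simp, by simp, by simp, by simp, by simp, by simp,
      by simp [Matrix.one_fin_two]⟩
  | cons x l ih =>
    obtain ⟨a, b, c, d, ε, ha, hb, hc, hd, hl, he, h⟩ := ih
    cases x
    · refine ⟨a, b, a + c, b + d, -ε, ha, hb, by omega, by omega, ?_, by simpa using he, ?_⟩
      · push_cast [List.length_cons]; omega
      · simp only [List.map_cons, List.prod_cons, Bool.false_eq_true, if_false,
          Matrix.SpecialLinearGroup.coe_mul, h, coe_S, coe_T]
        ext i j; fin_cases i <;> fin_cases j <;>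
          simp [Matrix.mul_apply, Fin.sum_univ_two] <;> ring
    · refine ⟨a + c, b + d, c, d, -ε, by omega, by omega, by omega, by omega, ?_,
        by simpa using he, ?_⟩
      · push_cast [List.length_cons]; omega
      · simp only [List.map_cons, List.prod_cons, if_true,
          Matrix.SpecialLinearGroup.coe_mul, h, coe_S, coe_T]
        ext i j; fin_cases i <;> fin_cases j <;>
          simp [Matrix.mul_apply, Fin.sum_univ_two] <;> ring

theorem word_trivial (e i j : ℕ) (l : List Bool) (hi : i < 3) (hj : j < 2)
    (h : (S * S : SL(2, ℤ)) ^ e * ((S * T) ^ i *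
      ((l.map fun b => if b then S * (S * T) else S * (S * T * (S * T))).prod * S ^ j)) = 1) :
    i = 0 ∧ j = 0 ∧ l = [] := by
  obtain ⟨a, b, c, d, ε, ha, hb, hc, hd, hl, he, hm⟩ := word_matrix l
  generalize (l.map fun b => if b then S * (S * T) else S * (S * T * (S * T))).prod = M at h hm
  have hS2 : (((S * S : SL(2, ℤ)) ^ e : SL(2, ℤ)) : Matrix (Fin 2) (Fin 2) ℤ)
      = !![(-1) ^ e, 0; 0, (-1) ^ e] := by
    clear h
    induction e with
    | zero => simp [Matrix.one_fin_two]
    | succ e ih =>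
      rw [pow_succ, Matrix.SpecialLinearGroup.coe_mul, ih,
        Matrix.SpecialLinearGroup.coe_mul, coe_S]
      ext i j; fin_cases i <;> fin_cases j <;>
        simp [Matrix.mul_apply, Fin.sum_univ_two, pow_succ]
  generalize (S * S : SL(2, ℤ)) ^ e = Z at h hS2
  have hε : ε ≠ 0 := by rintro rfl; simp at he
  have h' := congrArg (fun g : SL(2, ℤ) => (g : Matrix (Fin 2) (Fin 2) ℤ)) h
  simp only [Matrix.SpecialLinearGroup.coe_mul, Matrix.SpecialLinearGroup.coe_pow,
    hm, hS2, coe_S, coe_T] at h'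
  have h01 := congrFun (congrFun h' 0) 1
  have h10 := congrFun (congrFun h' 1) 0
  have key : ∀ x : ℤ, ε * x = 0 → x = 0 := fun x hx => by simpa [hε] using hx
  interval_cases i <;> interval_cases j <;>
    simp [pow_two, Matrix.mul_apply, Fin.sum_univ_two, hε] at h01 h10
  · refine ⟨rfl, rfl, List.length_eq_zero_iff.mp ?_⟩
    omega
  · omega
  · omega
  · have := key (b + d) (by linarith)
    omega
  · have := key (b + d) (by linarith)
    omega
  · have := key (a + c) (by linarith)
    omega

/-- The presentation of `SL(2, ℤ)` by generators `S`, `T` and relations `S⁴ = 1`, `(ST)³ = S²`: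
elements `s`, `t` of a monoid that satisfy these relations are the images of `S` and `T` under
a homomorphism. -/
theorem exists_hom_of_ST {M : Type*} [Monoid M] (s t : M) (h4 : s ^ 4 = 1)
    (h3 : (s * t) ^ 3 = s ^ 2) : ∃ φ : SL(2, ℤ) →* M, φ S = s ∧ φ T = t := by
  have hu6 : (s * t) ^ 6 = 1 := by
    rw [show 6 = 3 * 2 by norm_num, pow_mul, h3, ← pow_mul, h4]
  obtain ⟨s, rfl⟩ : IsUnit s := IsUnit.of_pow_eq_one h4 (by norm_num)
  obtain ⟨u, hu⟩ : IsUnit ((s : M) * t) := IsUnit.of_pow_eq_one hu6 (by norm_num)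
  have ht : t = ((s⁻¹ * u : Mˣ) : M) := by rw [Units.val_mul, hu, Units.inv_mul_cancel_left]
  rw [← hu] at h3
  have h4' : s ^ 4 = 1 := Units.ext (by simpa using h4)
  have h3' : u ^ 3 = s ^ 2 := Units.ext (by simpa using h3)
  have hU : (S * T) * ((S * T) * (S * T)) = (S * S : SL(2, ℤ)) := by
    ext i j; fin_cases i <;> fin_cases j <;> simp [Matrix.mul_apply, Fin.sum_univ_two, coe_S, coe_T]
  have hS4 : (S * S) * (S * S) = (1 : SL(2, ℤ)) := by
    ext i j; fin_cases i <;> fin_cases j <;> simp [Matrix.mul_apply, Fin.sum_univ_two, coe_S]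
  let σ : SL(2, ℤ) × Mˣ := (S, s)
  let υ : SL(2, ℤ) × Mˣ := (S * T, u)
  let K := Subgroup.closure {σ, υ}
  have inj : ∀ x ∈ K, x.1 = 1 → x = 1 := by
    intro x hx h1
    obtain ⟨e, i, j, l, hi, hj, rfl⟩ := word_form σ υ (σ * σ) rfl
      (Prod.ext hS4 (by simpa [σ, pow_succ, mul_assoc] using h4'))
      (Prod.ext hU (by simpa [σ, υ, pow_succ, mul_assoc] using h3')) x hx
    have hmap : ∀ l : List Bool,
        ((l.map fun b : Bool => if b then σ * υ else σ * (υ * υ)).prod).1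
          = (l.map fun b => if b then S * (S * T) else S * (S * T * (S * T))).prod := by
      intro l
      induction l with
      | nil => rfl
      | cons b l ih =>
        rw [List.map_cons, List.prod_cons, List.map_cons, List.prod_cons, Prod.fst_mul, ih]
        cases b <;> rfl
    have hfst : (S * S : SL(2, ℤ)) ^ e * ((S * T) ^ i *
      ((l.map fun b => if b then S * (S * T) else S * (S * T * (S * T))).prod * S ^ j)) = 1 := by
      rw [← h1, ← hmap]; rfl
    obtain ⟨rfl, rfl, rfl⟩ := word_trivial e i j l hi hj hfst
    have hz : (σ * σ) * (σ * σ) = 1 :=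
      Prod.ext hS4 (by simpa [σ, pow_succ, mul_assoc] using h4')
    have hne : σ * σ ≠ 1 := by
      intro h
      have := congrArg (fun g : SL(2, ℤ) × Mˣ => (g.1 : Matrix (Fin 2) (Fin 2) ℤ) 0 0) h
      simp [σ, coe_S, Matrix.mul_apply, Fin.sum_univ_two] at this
    have hS0 : (S * S : SL(2, ℤ)) ≠ 1 := by
      intro h
      have := congrArg (fun g : SL(2, ℤ) => (g : Matrix (Fin 2) (Fin 2) ℤ) 0 0) h
      simp [coe_S, Matrix.mul_apply, Fin.sum_univ_two] at this
    rcases Nat.even_or_odd' e with ⟨k, rfl | rfl⟩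
    · simp [pow_mul, pow_two (σ * σ), hz]
    · exfalso
      apply hS0
      simpa [pow_succ, pow_mul, hS4] using hfst
  let p : K →* SL(2, ℤ) := (MonoidHom.fst _ _).comp K.subtype
  have hp : Function.Bijective p := by
    constructor
    · rw [injective_iff_map_eq_one]
      intro x hx
      exact Subtype.ext (inj x.1 x.2 hx)
    · rw [← MonoidHom.range_eq_top, ← top_le_iff, ← SpecialLinearGroup.SL2Z_generators,
        Subgroup.closure_le]
      have hσ : σ ∈ K := Subgroup.subset_closure (by simp)
      have hυ : υ ∈ K := Subgroup.subset_closure (by simp)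
      rintro g (rfl | rfl)
      · exact ⟨⟨σ, hσ⟩, rfl⟩
      · exact ⟨⟨σ⁻¹ * υ, K.mul_mem (K.inv_mem hσ) hυ⟩, by simp [p, σ, υ]⟩
  let E := MulEquiv.ofBijective p hp
  have hσ : σ ∈ K := Subgroup.subset_closure (by simp)
  have hυ : υ ∈ K := Subgroup.subset_closure (by simp)
  have e1 : E.symm S = ⟨σ, hσ⟩ := by rw [MulEquiv.symm_apply_eq]; rfl
  have e2 : E.symm T = ⟨σ⁻¹ * υ, K.mul_mem (K.inv_mem hσ) hυ⟩ := by
    rw [MulEquiv.symm_apply_eq]; simp [E, p, σ, υ]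
  refine ⟨(Units.coeHom M).comp (((MonoidHom.snd _ _).comp K.subtype).comp E.symm.toMonoidHom),
    ?_, ?_⟩
  · simp [e1, σ]
  · simp [e2, σ, υ, ht]

end Presentation

/-- The homomorphism from `SL(2, ℤ)` with `S ↦ s`, `T ↦ t` (unique, as `S` and `T` generate). -/
def homOfST {M : Type*} [Monoid M] (s t : M) (h4 : s ^ 4 = 1) (h3 : (s * t) ^ 3 = s ^ 2) :
    SL(2, ℤ) →* M :=
  (exists_hom_of_ST s t h4 h3).choose

theorem homOfST_S {M : Type*} [Monoid M] (s t : M) (h4 : s ^ 4 = 1) (h3 : (s * t) ^ 3 = s ^ 2) :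
    homOfST s t h4 h3 ModularGroup.S = s :=
  (exists_hom_of_ST s t h4 h3).choose_spec.1

theorem homOfST_T {M : Type*} [Monoid M] (s t : M) (h4 : s ^ 4 = 1) (h3 : (s * t) ^ 3 = s ^ 2) :
    homOfST s t h4 h3 ModularGroup.T = t :=
  (exists_hom_of_ST s t h4 h3).choose_spec.2

/-! ### The three-dimensional representation -/

/-- `ζ_n = e^{2πi/n}`. -/
def zeta (n : ℕ) : ℂ := Complex.exp (2 * Real.pi * Complex.I / n)

def varrhoT (r : ℕ) : Matrix (Fin 3) (Fin 3) ℂ :=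
  !![(zeta r)⁻¹, 0, 0; 0, 0, zeta (2 * r); 0, zeta (2 * r), 0]

def varrhoS : Matrix (Fin 3) (Fin 3) ℂ :=
  !![0, 1, 0; 1, 0, 0; 0, 0, 1]

theorem zeta_sq (r : ℕ) : zeta (2 * r) * zeta (2 * r) = zeta r := by
  unfold zeta
  rw [← Complex.exp_add]
  congr 1
  push_cast
  rcases eq_or_ne (r : ℂ) 0 with h | h
  · simp [h]
  · field_simp
    norm_num

theorem varrhoS_sq : varrhoS * varrhoS = 1 := by
  ext i j; fin_cases i <;> fin_cases j <;> simp [varrhoS, Matrix.mul_apply, Fin.sum_univ_three]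

theorem varrhoST_cube (r : ℕ) : (varrhoS * varrhoT r) ^ 3 = 1 := by
  have h0 : zeta (2 * r) ≠ 0 := Complex.exp_ne_zero _
  have h : varrhoS * varrhoT r = !![0, 0, zeta (2 * r); (zeta r)⁻¹, 0, 0; 0, zeta (2 * r), 0] := by
    ext i j; fin_cases i <;> fin_cases j <;>
      simp [varrhoS, varrhoT, Matrix.mul_apply, Fin.sum_univ_three]
  have hz := zeta_sq r
  rw [h]
  generalize zeta (2 * r) = z at *
  rw [← hz, pow_succ, pow_two]
  ext i j; fin_cases i <;> fin_cases j <;>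
    simp [Matrix.mul_apply, Fin.sum_univ_three] <;> field_simp

/-- The representation `ϱ_r` of `SL(2, ℤ)` on `ℂ³` (column vectors). -/
def varrho (r : ℕ) : Representation ℂ SL(2, ℤ) (Fin 3 → ℂ) :=
  homOfST (Matrix.toLin' varrhoS) (Matrix.toLin' (varrhoT r))
    (by
      change Matrix.toLinAlgEquiv' varrhoS ^ 4 = 1
      rw [← map_pow, show 4 = 2 * 2 by norm_num, pow_mul, pow_two varrhoS, varrhoS_sq, one_pow,
        map_one])
    (by
      change (Matrix.toLinAlgEquiv' varrhoS * Matrix.toLinAlgEquiv' (varrhoT r)) ^ 3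
        = Matrix.toLinAlgEquiv' varrhoS ^ 2
      rw [← map_mul, ← map_pow, ← map_pow, varrhoST_cube, pow_two, varrhoS_sq])

theorem varrho_S (r : ℕ) : varrho r ModularGroup.S = Matrix.toLin' varrhoS := homOfST_S _ _ _ _

theorem varrho_T (r : ℕ) : varrho r ModularGroup.T = Matrix.toLin' (varrhoT r) := homOfST_T _ _ _ _

/-! ### The finite quadratic module -/

/-- The discriminant group `𝒜_r ≅ L_r' / L_r` of the lattice `L_r` of integral matrices with even
lower left entry and quadratic form `r · det`. The quadruple `(h₀, h₁, h₂, h₃)` stands for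
the coset of the matrix `dualVec r h₀ h₁ h₂ h₃`. -/
abbrev Disc (r : ℕ) : Type := ZMod r × ZMod (2 * r) × ZMod (2 * r) × ZMod r

/-- The element `r⁻¹ (x₀, x₁/2; x₂, x₃)` of the dual lattice `L_r'`. -/
def dualVec (r : ℕ) (x₀ x₁ x₂ x₃ : ℤ) : Matrix (Fin 2) (Fin 2) ℚ :=
  (1 / (r : ℚ)) • !![(x₀ : ℚ), (x₁ : ℚ) / 2; (x₂ : ℚ), (x₃ : ℚ)]

/-- The matrices `dualVec r x₀ x₁ x₂ x₃` are exactly the elements of the dual of the lattice `L_r`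
with respect to the bilinear form of the quadratic form `r · det`. -/
theorem mem_dual_iff (r : ℕ) [NeZero r] (X : Matrix (Fin 2) (Fin 2) ℚ) :
    (∀ a b c d : ℤ, ∃ n : ℤ, (r : ℚ) * ((X + !![(a : ℚ), (b : ℚ); 2 * (c : ℚ), (d : ℚ)]).det - X.det
        - (!![(a : ℚ), (b : ℚ); 2 * (c : ℚ), (d : ℚ)]).det) = n) ↔
      ∃ x₀ x₁ x₂ x₃ : ℤ, X = dualVec r x₀ x₁ x₂ x₃ := by
  have hr : (r : ℚ) ≠ 0 := Nat.cast_ne_zero.mpr (NeZero.ne r)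
  constructor
  · intro h
    obtain ⟨n0, h0⟩ := h 0 0 0 1
    obtain ⟨n1, h1⟩ := h 0 0 1 0
    obtain ⟨n2, h2⟩ := h 0 1 0 0
    obtain ⟨n3, h3⟩ := h 1 0 0 0
    simp [Matrix.det_fin_two] at h0 h1 h2 h3
    refine ⟨n0, -n1, -n2, n3, ?_⟩
    ext i j; fin_cases i <;> fin_cases j <;> simp [dualVec] <;> field_simp <;> linarith
  · rintro ⟨x₀, x₁, x₂, x₃, rfl⟩ a b c d
    refine ⟨x₀ * d + x₃ * a - x₁ * c - x₂ * b, ?_⟩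
    simp [dualVec, Matrix.det_fin_two]
    field_simp
    ring

/-- The coset of `dualVec r x₀ x₁ x₂ x₃`. -/
def cls (r : ℕ) (x₀ x₁ x₂ x₃ : ℤ) : Disc r := ((x₀ : ZMod r), (x₁ : ZMod (2 * r)), (x₂ : ZMod (2 * r)), (x₃ : ZMod r))

/-- Two elements of the dual lattice have the same class if and only if their difference lies
in the lattice `L_r`. -/
theorem cls_eq_iff (r : ℕ) [NeZero r] (x₀ x₁ x₂ x₃ y₀ y₁ y₂ y₃ : ℤ) :
    cls r x₀ x₁ x₂ x₃ = cls r y₀ y₁ y₂ y₃ ↔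
      ∃ a b c d : ℤ, dualVec r x₀ x₁ x₂ x₃ - dualVec r y₀ y₁ y₂ y₃
        = !![(a : ℚ), (b : ℚ); 2 * (c : ℚ), (d : ℚ)] := by
  have hr : (r : ℚ) ≠ 0 := Nat.cast_ne_zero.mpr (NeZero.ne r)
  have e : ∀ (m : ℕ) (x y : ℤ), (x : ZMod m) = y ↔ (m : ℤ) ∣ x - y := fun m x y => by
    rw [eq_comm, ZMod.intCast_eq_intCast_iff_dvd_sub]
  simp only [cls, Prod.mk.injEq, e]
  constructor
  · rintro ⟨⟨a, ha⟩, ⟨b, hb⟩, ⟨c, hc⟩, ⟨d, hd⟩⟩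
    obtain rfl := eq_add_of_sub_eq ha
    obtain rfl := eq_add_of_sub_eq hb
    obtain rfl := eq_add_of_sub_eq hc
    obtain rfl := eq_add_of_sub_eq hd
    refine ⟨a, b, c, d, ?_⟩
    ext i j; fin_cases i <;> fin_cases j <;> simp [dualVec] <;> field_simp <;> ring
  · rintro ⟨a, b, c, d, h⟩
    have h00 := congrFun (congrFun h 0) 0
    have h01 := congrFun (congrFun h 0) 1
    have h10 := congrFun (congrFun h 1) 0
    have h11 := congrFun (congrFun h 1) 1
    simp [dualVec] at h00 h01 h10 h11
    field_simp at h00 h01 h10 h11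
    refine ⟨⟨a, ?_⟩, ⟨b, ?_⟩, ⟨c, ?_⟩, ⟨d, ?_⟩⟩
    · exact_mod_cast h00
    · have : (x₁ : ℚ) - y₁ = 2 * r * b := by linarith
      exact_mod_cast this
    · have : (x₂ : ℚ) - y₂ = 2 * r * c := by linarith
      exact_mod_cast this
    · exact_mod_cast h11

/-- Multiplication by two, `ℤ/r → ℤ/2r`. -/
def dbl (r : ℕ) : ZMod r →+ ZMod (2 * r) :=
  ZMod.lift r ⟨(AddMonoidHom.mulLeft (2 : ZMod (2 * r))).comp (Int.castAddHom (ZMod (2 * r))), by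
    have h : ((2 * r : ℕ) : ZMod (2 * r)) = 0 := ZMod.natCast_self _
    push_cast at h
    simpa only [AddMonoidHom.comp_apply, Int.coe_castAddHom, AddMonoidHom.coe_mulLeft,
      Int.cast_natCast] using h⟩

/-- Reduction `ℤ/2r → ℤ/r`. -/
def red (r : ℕ) : ZMod (2 * r) →+* ZMod r := ZMod.castHom (dvd_mul_left r 2) (ZMod r)

@[simp] theorem dbl_intCast (r : ℕ) (x : ℤ) : dbl r (x : ZMod r) = 2 * (x : ZMod (2 * r)) := by
  simp [dbl]

@[simp] theorem red_intCast (r : ℕ) (x : ℤ) : red r (x : ZMod (2 * r)) = (x : ZMod r) := by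
  simp [red]

/-- `2r` times the quadratic form `Q_r(h) = (2 h₀ h₃ - h₁ h₂) / 2r ∈ (1/2r)ℤ/ℤ`. -/
def qNum (r : ℕ) (h : Disc r) : ZMod (2 * r) := dbl r (h.1 * h.2.2.2) - h.2.1 * h.2.2.1

/-- `2r` times the associated bilinear form `(g, h) = Q_r(g + h) - Q_r(g) - Q_r(h)`. -/
def bNum (r : ℕ) (g h : Disc r) : ZMod (2 * r) := qNum r (g + h) - qNum r g - qNum r h

/-- `e(x / 2r) = exp(2πi x / 2r)` for `x ∈ ℤ/2r`. -/
def ee (r : ℕ) [NeZero r] : AddChar (ZMod (2 * r)) ℂ := ZMod.stdAddChar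

/-- The quadratic form on the classes is the one induced by `r · det`. -/
theorem ee_qNum_cls (r : ℕ) [NeZero r] (x₀ x₁ x₂ x₃ : ℤ) :
    ee r (qNum r (cls r x₀ x₁ x₂ x₃)) =
      Complex.exp (2 * Real.pi * Complex.I * ((r * (dualVec r x₀ x₁ x₂ x₃).det : ℚ) : ℂ)) := by
  have hr : (r : ℂ) ≠ 0 := Nat.cast_ne_zero.mpr (NeZero.ne r)
  have : qNum r (cls r x₀ x₁ x₂ x₃) = ((2 * (x₀ * x₃) - x₁ * x₂ : ℤ) : ZMod (2 * r)) := by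
    simp only [qNum, cls]
    rw [← Int.cast_mul, dbl_intCast]
    push_cast; ring
  rw [this, ee, ZMod.stdAddChar_coe]
  congr 1
  simp [dualVec, Matrix.det_fin_two]
  field_simp

theorem bNum_eq (r : ℕ) (g h : Disc r) : bNum r g h =
    dbl r (g.1 * h.2.2.2 + h.1 * g.2.2.2) - g.2.1 * h.2.2.1 - h.2.1 * g.2.2.1 := by
  simp only [bNum, qNum, Prod.fst_add, Prod.snd_add, add_mul, mul_add, map_add]
  ring

theorem ee_dbl_ne (r : ℕ) [NeZero r] {x : ZMod r} (hx : ee r (dbl r x) = 1) : x = 0 := by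
  obtain ⟨x, rfl⟩ := ZMod.intCast_surjective x
  have h1 : dbl r (x : ZMod r) = 0 :=
    ZMod.injective_stdAddChar (hx.trans (AddChar.map_zero_eq_one _).symm)
  rw [dbl_intCast] at h1
  have h2 : ((2 * x : ℤ) : ZMod (2 * r)) = 0 := by push_cast; exact h1
  rw [ZMod.intCast_zmod_eq_zero_iff_dvd] at h2 ⊢
  push_cast at h2
  exact Int.dvd_of_mul_dvd_mul_left (by norm_num) h2

/-- Orthogonality relation for the bilinear form. -/
theorem sum_ee_bNum (r : ℕ) [NeZero r] (g : Disc r) :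
    ∑ h : Disc r, ee r (bNum r g h) = if g = 0 then (Fintype.card (Disc r) : ℂ) else 0 := by
  classical
  let χ : AddChar (Disc r) ℂ :=
    { toFun := fun h => ee r (bNum r g h)
      map_zero_eq_one' := by simp [bNum_eq]
      map_add_eq_mul' := fun x y => by
        rw [← AddChar.map_add_eq_mul]
        congr 1
        simp only [bNum_eq, Prod.fst_add, Prod.snd_add, add_mul, mul_add, map_add]
        ring }
  have h := AddChar.sum_eq_ite χ
  change ∑ h : Disc r, ee r (bNum r g h) = _ at h
  rw [h]
  have hiff : χ = 0 ↔ g = 0 := by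
    constructor
    · intro hχ
      have hall : ∀ h, ee r (bNum r g h) = 1 := fun h => by
        change χ h = 1
        rw [hχ]; rfl
      have e0 : ∀ x : ZMod (2 * r), ee r x = 1 → x = 0 := fun x hx =>
        ZMod.injective_stdAddChar (hx.trans (AddChar.map_zero_eq_one _).symm)
      obtain ⟨g0, g1, g2, g3⟩ := g
      have h0 := hall (0, 0, 0, 1)
      have h1 := hall (0, 0, 1, 0)
      have h2 := hall (0, 1, 0, 0)
      have h3 := hall (1, 0, 0, 0)
      simp [bNum_eq] at h0 h1 h2 h3
      have i0 := ee_dbl_ne r h0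
      have i3 := ee_dbl_ne r h3
      have i1 : g1 = 0 := by
        have := e0 (-g1) h1
        simpa using this
      have i2 : g2 = 0 := by
        have := e0 (-g2) h2
        simpa using this
      simp [i0, i1, i2, i3]
    · rintro rfl
      ext h
      change ee r (bNum r 0 h) = 1
      simp [bNum_eq]
  simp only [hiff]

theorem card_Disc (r : ℕ) [NeZero r] : Fintype.card (Disc r) = (2 * r ^ 2) ^ 2 := by
  simp only [Disc, Fintype.card_prod, ZMod.card]
  ring

theorem sqrt_card_Disc (r : ℕ) [NeZero r] :
    (Real.sqrt (Fintype.card (Disc r)) : ℂ) = 2 * (r : ℂ) ^ 2 := by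
  rw [card_Disc, Nat.cast_pow, Real.sqrt_sq (by positivity)]
  push_cast; ring

/-- The Gauss sum of the quadratic form. -/
theorem gauss_sum (r : ℕ) [NeZero r] :
    ∑ h : Disc r, ee r (-qNum r h) = 2 * (r : ℂ) ^ 2 := by
  classical
  have s1 : ∀ x : ZMod r, ∑ y : ZMod r, ee r (-dbl r (x * y)) = if x = 0 then (r : ℂ) else 0 := by
    intro x
    let χ : AddChar (ZMod r) ℂ :=
      { toFun := fun y => ee r (-dbl r (x * y))
        map_zero_eq_one' := by simp
        map_add_eq_mul' := fun y z => by
          rw [← AddChar.map_add_eq_mul]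
          congr 1
          rw [mul_add, map_add]; ring }
    have h := AddChar.sum_eq_ite χ
    change ∑ y : ZMod r, ee r (-dbl r (x * y)) = _ at h
    rw [h, ZMod.card]
    have hiff : χ = 0 ↔ x = 0 := by
      constructor
      · intro hχ
        have h1 : ee r (-dbl r (x * 1)) = 1 := by
          change χ 1 = 1
          rw [hχ]; rfl
        apply ee_dbl_ne r
        rw [mul_one, AddChar.map_neg_eq_inv, inv_eq_one] at h1
        exact h1
      · rintro rfl
        ext y
        change ee r (-dbl r (0 * y)) = 1
        simp
    simp only [hiff]
  have s2 : ∀ x : ZMod (2 * r), ∑ y : ZMod (2 * r), ee r (x * y)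
      = if x = 0 then ((2 * r : ℕ) : ℂ) else 0 := by
    intro x
    have h := AddChar.sum_mulShift x (ZMod.isPrimitive_stdAddChar (2 * r))
    simp only [mul_comm _ x, ZMod.card] at h
    rw [ee, h]
    push_cast; rfl
  have hsplit : ∀ h : Disc r, ee r (-qNum r h)
      = ee r (-dbl r (h.1 * h.2.2.2)) * ee r (h.2.1 * h.2.2.1) := by
    intro h
    rw [← AddChar.map_add_eq_mul]; congr 1
    simp only [qNum]; ring
  simp only [hsplit, Fintype.sum_prod_type]
  simp only [← Finset.sum_mul, ← Finset.mul_sum, s1, s2, Finset.sum_ite_eq', Finset.mem_univ,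
    if_true]
  push_cast; ring

/-! ### The Weil representation -/

/-- `U_r = ℂ[𝒜_r]`; the basis vector `𝔢_h` is `Pi.single h 1`. -/
abbrev U (r : ℕ) : Type := Disc r → ℂ

/-- `𝔢_h ↦ e(-Q_r(h)) 𝔢_h`. -/
def weilT (r : ℕ) [NeZero r] : U r →ₗ[ℂ] U r where
  toFun f := fun h => ee r (-qNum r h) * f h
  map_add' f g := by ext h; simp [mul_add]
  map_smul' c f := by ext h; simp; ring

/-- `𝔢_h ↦ |𝒜_r|^{-1/2} ∑_μ e((μ, h)) 𝔢_μ`. -/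
def weilS (r : ℕ) [NeZero r] : U r →ₗ[ℂ] U r where
  toFun f := fun μ => (Real.sqrt (Fintype.card (Disc r)) : ℂ)⁻¹ * ∑ h, ee r (bNum r μ h) * f h
  map_add' f g := by ext μ; simp [mul_add, Finset.sum_add_distrib]
  map_smul' c f := by
    ext μ
    simp only [Pi.smul_apply, smul_eq_mul, RingHom.id_apply, Finset.mul_sum]
    exact Finset.sum_congr rfl fun _ _ => by ring

theorem weilT_single (r : ℕ) [NeZero r] (h : Disc r) :
    weilT r (Pi.single h 1) = ee r (-qNum r h) • Pi.single h 1 := by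
  ext μ
  rcases eq_or_ne μ h with rfl | hμ
  · simp [weilT]
  · simp [weilT, hμ]

theorem weilS_single (r : ℕ) [NeZero r] (h : Disc r) :
    weilS r (Pi.single h 1) = (Real.sqrt (Fintype.card (Disc r)) : ℂ)⁻¹ •
      ∑ μ, ee r (bNum r μ h) • (Pi.single μ 1 : U r) := by
  ext μ
  simp [weilS, Finset.sum_apply, Pi.single_apply]

theorem bNum_comm (r : ℕ) (g h : Disc r) : bNum r g h = bNum r h g := by
  simp only [bNum, add_comm g h]; ring

theorem bNum_add (r : ℕ) (g g' h : Disc r) : bNum r (g + g') h = bNum r g h + bNum r g' h := by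
  simp only [bNum_eq, Prod.fst_add, Prod.snd_add, add_mul, mul_add, map_add]; ring

theorem weilS_sq (r : ℕ) [NeZero r] (f : U r) (μ : Disc r) : weilS r (weilS r f) μ = f (-μ) := by
  classical
  have hc : (Fintype.card (Disc r) : ℂ) ≠ 0 := Nat.cast_ne_zero.mpr Fintype.card_ne_zero
  have hs : (Real.sqrt (Fintype.card (Disc r)) : ℂ) * (Real.sqrt (Fintype.card (Disc r)) : ℂ)
      = Fintype.card (Disc r) := by
    rw [← Complex.ofReal_mul, Real.mul_self_sqrt (by positivity)]; simp
  have hs0 : (Real.sqrt (Fintype.card (Disc r)) : ℂ) ≠ 0 := by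
    intro h; rw [h, mul_zero] at hs; exact hc hs.symm
  simp only [weilS, LinearMap.coe_mk, AddHom.coe_mk]
  have h1 : ∑ h, ee r (bNum r μ h) * ((Real.sqrt (Fintype.card (Disc r)) : ℂ)⁻¹ *
      ∑ k, ee r (bNum r h k) * f k)
      = (Real.sqrt (Fintype.card (Disc r)) : ℂ)⁻¹ *
        ∑ k, (∑ h, ee r (bNum r (μ + k) h)) * f k := by
    simp only [Finset.mul_sum, Finset.sum_mul]
    rw [Finset.sum_comm]
    refine Finset.sum_congr rfl fun k _ => Finset.sum_congr rfl fun h _ => ?_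
    rw [bNum_add, AddChar.map_add_eq_mul, bNum_comm r k h]; ring
  rw [h1]
  have h2 : ∀ k, (if μ + k = 0 then (Fintype.card (Disc r) : ℂ) else 0) * f k
      = if k = -μ then (Fintype.card (Disc r) : ℂ) * f k else 0 := by
    intro k
    have : μ + k = 0 ↔ k = -μ := by rw [add_comm, add_eq_zero_iff_eq_neg]
    simp only [this, ite_mul, zero_mul]
  simp only [sum_ee_bNum, h2, Finset.sum_ite_eq', Finset.mem_univ, if_true]
  rw [← hs]; field_simp

theorem weilS_pow_four (r : ℕ) [NeZero r] : weilS r ^ 4 = 1 := by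
  refine LinearMap.ext fun f => funext fun μ => ?_
  simp [pow_succ, Module.End.mul_apply, weilS_sq]

theorem qNum_neg (r : ℕ) (h : Disc r) : qNum r (-h) = qNum r h := by simp [qNum]

theorem weilSTS (r : ℕ) [NeZero r] (f : U r) (μ : Disc r) :
    weilT r (weilS r (weilT r (weilS r (weilT r f)))) μ = weilS r f μ := by
  have key : ∀ k : Disc r, ∑ h, ee r (bNum r μ h) * (ee r (-qNum r h) * ee r (bNum r h k))
      = ee r (qNum r (μ + k)) * (2 * (r : ℂ) ^ 2) := by
    intro k
    rw [← gauss_sum, Finset.mul_sum, ← Equiv.sum_comp (Equiv.subRight (μ + k))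
      (fun h => ee r (qNum r (μ + k)) * ee r (-qNum r h))]
    refine Finset.sum_congr rfl fun h _ => ?_
    simp only [← AddChar.map_add_eq_mul]
    congr 1
    have h1 : qNum r (h - (μ + k)) = qNum r h + qNum r (μ + k) - bNum r h (μ + k) := by
      have h2 := bNum_eq r h (-(μ + k))
      have h3 := bNum_eq r h (μ + k)
      rw [bNum, ← sub_eq_add_neg, qNum_neg] at h2
      have h4 : dbl r (h.1 * (-(μ + k)).2.2.2 + (-(μ + k)).1 * h.2.2.2) - h.2.1 * (-(μ + k)).2.2.1
          - (-(μ + k)).2.1 * h.2.2.1 = - bNum r h (μ + k) := by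
        rw [h3]
        simp only [Prod.fst_neg, Prod.snd_neg, mul_neg, neg_mul, map_add, map_neg]
        ring
      rw [h4] at h2
      linear_combination h2
    simp only [Equiv.subRight_apply, h1]
    rw [bNum_comm r h (μ + k), bNum_add, bNum_comm r k h]
    ring
  have hr : (r : ℂ) ≠ 0 := Nat.cast_ne_zero.mpr (NeZero.ne r)
  simp only [weilS, weilT, LinearMap.coe_mk, AddHom.coe_mk, sqrt_card_Disc]
  have h1 : ∑ h, ee r (bNum r μ h) * (ee r (-qNum r h) * ((2 * (r : ℂ) ^ 2)⁻¹ *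
      ∑ k, ee r (bNum r h k) * (ee r (-qNum r k) * f k)))
      = (2 * (r : ℂ) ^ 2)⁻¹ * ∑ k, (∑ h, ee r (bNum r μ h) * (ee r (-qNum r h) *
          ee r (bNum r h k))) * (ee r (-qNum r k) * f k) := by
    simp only [Finset.mul_sum, Finset.sum_mul]
    rw [Finset.sum_comm]
    refine Finset.sum_congr rfl fun k _ => Finset.sum_congr rfl fun h _ => ?_
    ring
  rw [h1]
  simp only [key, Finset.mul_sum]
  refine Finset.sum_congr rfl fun k _ => ?_
  have h2 : ee r (bNum r μ k) = ee r (-qNum r μ) * ee r (qNum r (μ + k)) * ee r (-qNum r k) := by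
    simp only [← AddChar.map_add_eq_mul]
    congr 1
    rw [bNum]; ring
  rw [h2]
  field_simp

theorem weilST_cube (r : ℕ) [NeZero r] : (weilS r * weilT r) ^ 3 = weilS r ^ 2 := by
  refine LinearMap.ext fun f => ?_
  have h : weilT r (weilS r (weilT r (weilS r (weilT r f)))) = weilS r f := by
    ext μ; exact weilSTS r f μ
  simp [pow_succ, Module.End.mul_apply, h]

/-- The Weil representation `ω_r` of `SL(2, ℤ)` on `U_r`. -/
def weilRep (r : ℕ) [NeZero r] : Representation ℂ SL(2, ℤ) (U r) :=
  homOfST (weilS r) (weilT r) (weilS_pow_four r) (weilST_cube r)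

theorem weilRep_S (r : ℕ) [NeZero r] : weilRep r ModularGroup.S = weilS r := homOfST_S _ _ _ _

theorem weilRep_T (r : ℕ) [NeZero r] : weilRep r ModularGroup.T = weilT r := homOfST_T _ _ _ _

/-! ### The groups acting on the finite quadratic module -/

/-- `Γ₀(2)`. -/
abbrev G2 : Subgroup SL(2, ℤ) := CongruenceSubgroup.Gamma0 2

/-- Left multiplication by `g ∈ Γ₀(2)` on `L_r' / L_r`. -/
def actL (r : ℕ) (g : SL(2, ℤ)) (h : Disc r) : Disc r :=
  ((g 0 0 : ZMod r) * h.1 + (g 0 1 : ZMod r) * red r h.2.2.1,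
    (g 0 0 : ZMod (2 * r)) * h.2.1 + (g 0 1 : ZMod (2 * r)) * dbl r h.2.2.2,
    ((g 1 0 / 2 : ℤ) : ZMod (2 * r)) * dbl r h.1 + (g 1 1 : ZMod (2 * r)) * h.2.2.1,
    ((g 1 0 / 2 : ℤ) : ZMod r) * red r h.2.1 + (g 1 1 : ZMod r) * h.2.2.2)

/-- Right multiplication by `g ∈ Γ₀(2)` on `L_r' / L_r`. -/
def actR (r : ℕ) (g : SL(2, ℤ)) (h : Disc r) : Disc r :=
  ((g 0 0 : ZMod r) * h.1 + ((g 1 0 / 2 : ℤ) : ZMod r) * red r h.2.1,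
    (g 0 1 : ZMod (2 * r)) * dbl r h.1 + (g 1 1 : ZMod (2 * r)) * h.2.1,
    (g 0 0 : ZMod (2 * r)) * h.2.2.1 + ((g 1 0 / 2 : ℤ) : ZMod (2 * r)) * dbl r h.2.2.2,
    (g 0 1 : ZMod r) * red r h.2.2.1 + (g 1 1 : ZMod r) * h.2.2.2)

theorem cls_surjective (r : ℕ) (h : Disc r) : ∃ x₀ x₁ x₂ x₃ : ℤ, h = cls r x₀ x₁ x₂ x₃ := by
  obtain ⟨h0, h1, h2, h3⟩ := h
  obtain ⟨x0, rfl⟩ := ZMod.intCast_surjective h0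
  obtain ⟨x1, rfl⟩ := ZMod.intCast_surjective h1
  obtain ⟨x2, rfl⟩ := ZMod.intCast_surjective h2
  obtain ⟨x3, rfl⟩ := ZMod.intCast_surjective h3
  exact ⟨x0, x1, x2, x3, rfl⟩

theorem exists_half {g : SL(2, ℤ)} (hg : g ∈ G2) : ∃ c : ℤ, g 1 0 = 2 * c := by
  rw [CongruenceSubgroup.Gamma0_mem, ZMod.intCast_zmod_eq_zero_iff_dvd] at hg
  exact_mod_cast hg

theorem actL_cls (r : ℕ) {g : SL(2, ℤ)} {c : ℤ} (hc : g 1 0 = 2 * c) (x₀ x₁ x₂ x₃ : ℤ) :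
    actL r g (cls r x₀ x₁ x₂ x₃) = cls r (g 0 0 * x₀ + g 0 1 * x₂) (g 0 0 * x₁ + 2 * g 0 1 * x₃)
      (2 * c * x₀ + g 1 1 * x₂) (c * x₁ + g 1 1 * x₃) := by
  have : g 1 0 / 2 = c := by omega
  simp only [actL, cls, this, dbl_intCast, red_intCast]
  push_cast
  refine Prod.ext rfl (Prod.ext ?_ (Prod.ext ?_ rfl)) <;> dsimp only <;> ring

theorem actR_cls (r : ℕ) {g : SL(2, ℤ)} {c : ℤ} (hc : g 1 0 = 2 * c) (x₀ x₁ x₂ x₃ : ℤ) :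
    actR r g (cls r x₀ x₁ x₂ x₃) = cls r (g 0 0 * x₀ + c * x₁) (2 * g 0 1 * x₀ + g 1 1 * x₁)
      (g 0 0 * x₂ + 2 * c * x₃) (g 0 1 * x₂ + g 1 1 * x₃) := by
  have : g 1 0 / 2 = c := by omega
  simp only [actR, cls, this, dbl_intCast, red_intCast]
  push_cast
  refine Prod.ext rfl (Prod.ext ?_ (Prod.ext ?_ rfl)) <;> dsimp only <;> ring

/-- `actL` is induced by left multiplication of matrices. -/
theorem actL_dualVec (r : ℕ) {g : SL(2, ℤ)} (hg : g ∈ G2) (x₀ x₁ x₂ x₃ : ℤ) :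
    ∃ y₀ y₁ y₂ y₃ : ℤ, actL r g (cls r x₀ x₁ x₂ x₃) = cls r y₀ y₁ y₂ y₃ ∧
      g.1.map (Int.cast : ℤ → ℚ) * dualVec r x₀ x₁ x₂ x₃ = dualVec r y₀ y₁ y₂ y₃ := by
  obtain ⟨c, hc⟩ := exists_half hg
  refine ⟨_, _, _, _, actL_cls r hc x₀ x₁ x₂ x₃, ?_⟩
  have hc' : g.1 1 0 = 2 * c := hc
  ext i j; fin_cases i <;> fin_cases j <;>
    simp [dualVec, Matrix.mul_apply, Fin.sum_univ_two, hc'] <;> ring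

/-- `actR` is induced by right multiplication of matrices. -/
theorem actR_dualVec (r : ℕ) {g : SL(2, ℤ)} (hg : g ∈ G2) (x₀ x₁ x₂ x₃ : ℤ) :
    ∃ y₀ y₁ y₂ y₃ : ℤ, actR r g (cls r x₀ x₁ x₂ x₃) = cls r y₀ y₁ y₂ y₃ ∧
      dualVec r x₀ x₁ x₂ x₃ * g.1.map (Int.cast : ℤ → ℚ) = dualVec r y₀ y₁ y₂ y₃ := by
  obtain ⟨c, hc⟩ := exists_half hg
  refine ⟨_, _, _, _, actR_cls r hc x₀ x₁ x₂ x₃, ?_⟩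
  have hc' : g.1 1 0 = 2 * c := hc
  ext i j; fin_cases i <;> fin_cases j <;>
    simp [dualVec, Matrix.mul_apply, Fin.sum_univ_two, hc'] <;> ring

theorem actL_one (r : ℕ) (h : Disc r) : actL r 1 h = h := by simp [actL]

theorem actR_one (r : ℕ) (h : Disc r) : actR r 1 h = h := by simp [actR]

theorem mul_entry (g g' : SL(2, ℤ)) (i j : Fin 2) :
    (g * g') i j = g i 0 * g' 0 j + g i 1 * g' 1 j := by
  simp [Matrix.mul_apply, Fin.sum_univ_two]

theorem actL_mul (r : ℕ) {g g' : SL(2, ℤ)} (hg : g ∈ G2) (hg' : g' ∈ G2) (h : Disc r) :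
    actL r (g * g') h = actL r g (actL r g' h) := by
  obtain ⟨c, hc⟩ := exists_half hg
  obtain ⟨c', hc'⟩ := exists_half hg'
  have hm : (g * g') 1 0 = 2 * (c * g' 0 0 + g 1 1 * c') := by rw [mul_entry, hc, hc']; ring
  obtain ⟨x₀, x₁, x₂, x₃, rfl⟩ := cls_surjective r h
  rw [actL_cls r hm, actL_cls r hc', actL_cls r hc]
  simp only [mul_entry, hc, hc']
  congr 1 <;> ring

theorem actR_mul (r : ℕ) {g g' : SL(2, ℤ)} (hg : g ∈ G2) (hg' : g' ∈ G2) (h : Disc r) :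
    actR r (g * g') h = actR r g' (actR r g h) := by
  obtain ⟨c, hc⟩ := exists_half hg
  obtain ⟨c', hc'⟩ := exists_half hg'
  have hm : (g * g') 1 0 = 2 * (c * g' 0 0 + g 1 1 * c') := by rw [mul_entry, hc, hc']; ring
  obtain ⟨x₀, x₁, x₂, x₃, rfl⟩ := cls_surjective r h
  rw [actR_cls r hm, actR_cls r hc, actR_cls r hc']
  simp only [mul_entry, hc, hc']
  congr 1 <;> ring

theorem actL_actR (r : ℕ) {g g' : SL(2, ℤ)} (hg : g ∈ G2) (hg' : g' ∈ G2) (h : Disc r) :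
    actL r g (actR r g' h) = actR r g' (actL r g h) := by
  obtain ⟨c, hc⟩ := exists_half hg
  obtain ⟨c', hc'⟩ := exists_half hg'
  obtain ⟨x₀, x₁, x₂, x₃, rfl⟩ := cls_surjective r h
  rw [actR_cls r hc', actL_cls r hc, actL_cls r hc, actR_cls r hc']
  congr 1 <;> ring

theorem actL_add (r : ℕ) (g : SL(2, ℤ)) (h h' : Disc r) :
    actL r g (h + h') = actL r g h + actL r g h' := by
  simp only [actL, Prod.fst_add, Prod.snd_add, map_add, mul_add, Prod.mk_add_mk]
  refine Prod.ext ?_ (Prod.ext ?_ (Prod.ext ?_ ?_)) <;> dsimp only <;> ring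

theorem actR_add (r : ℕ) (g : SL(2, ℤ)) (h h' : Disc r) :
    actR r g (h + h') = actR r g h + actR r g h' := by
  simp only [actR, Prod.fst_add, Prod.snd_add, map_add, mul_add, Prod.mk_add_mk]
  refine Prod.ext ?_ (Prod.ext ?_ (Prod.ext ?_ ?_)) <;> dsimp only <;> ring

/-- The action `(g₁, g₂) · X = g₁ X g₂⁻¹` of `Γ₀(2) × Γ₀(2)` on `L_r' / L_r`. -/
def soAct (r : ℕ) : G2 × G2 →* Equiv.Perm (Disc r) where
  toFun g :=
    { toFun := fun h => actL r g.1 (actR r (g.2⁻¹ : G2) h)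
      invFun := fun h => actL r (g.1⁻¹ : G2) (actR r g.2 h)
      left_inv := fun h => by
        change actL r (g.1⁻¹ : G2) (actR r g.2 (actL r g.1 (actR r (g.2⁻¹ : G2) h))) = h
        rw [← actL_actR r g.1.2 g.2.2,
          ← actL_mul r (g.1⁻¹).2 g.1.2, ← actR_mul r (g.2⁻¹).2 g.2.2,
          ← Subgroup.coe_mul, ← Subgroup.coe_mul, inv_mul_cancel, inv_mul_cancel,
          Subgroup.coe_one, actR_one, actL_one]
      right_inv := fun h => by
        change actL r g.1 (actR r (g.2⁻¹ : G2) (actL r (g.1⁻¹ : G2) (actR r g.2 h))) = h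
        rw [← actL_actR r (g.1⁻¹).2 (g.2⁻¹).2, ← actR_mul r g.2.2 (g.2⁻¹).2,
          ← actL_mul r g.1.2 (g.1⁻¹).2,
          ← Subgroup.coe_mul, ← Subgroup.coe_mul, mul_inv_cancel, mul_inv_cancel,
          Subgroup.coe_one, actR_one, actL_one] }
  map_one' := by
    ext1 h
    change actL r ((1 : G2) : SL(2, ℤ)) (actR r (((1 : G2)⁻¹ : G2) : SL(2, ℤ)) h) = h
    rw [inv_one, Subgroup.coe_one, actR_one, actL_one]
  map_mul' g g' := by
    ext1 h
    change actL r ((g.1 * g'.1 : G2) : SL(2, ℤ)) (actR r (((g.2 * g'.2)⁻¹ : G2) : SL(2, ℤ)) h)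
      = actL r g.1 (actR r (g.2⁻¹ : G2) (actL r g'.1 (actR r (g'.2⁻¹ : G2) h)))
    rw [mul_inv_rev, Subgroup.coe_mul, Subgroup.coe_mul, actL_mul r g.1.2 g'.1.2,
      actR_mul r (g'.2⁻¹).2 (g.2⁻¹).2, actL_actR r g'.1.2 (g.2⁻¹).2]

theorem soAct_apply (r : ℕ) (g : G2 × G2) (h : Disc r) :
    soAct r g h = actL r g.1 (actR r (g.2⁻¹ : G2) h) := rfl

/-- The action is additive. -/
theorem soAct_add (r : ℕ) (g : G2 × G2) (h h' : Disc r) :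
    soAct r g (h + h') = soAct r g h + soAct r g h' := by
  simp only [soAct_apply, actR_add, actL_add]

theorem qNum_cls (r : ℕ) (x₀ x₁ x₂ x₃ : ℤ) :
    qNum r (cls r x₀ x₁ x₂ x₃) = ((2 * (x₀ * x₃) - x₁ * x₂ : ℤ) : ZMod (2 * r)) := by
  simp only [qNum, cls]
  rw [← Int.cast_mul, dbl_intCast]
  push_cast; ring

/-- The action preserves the quadratic form. -/
theorem qNum_soAct (r : ℕ) (g : G2 × G2) (h : Disc r) : qNum r (soAct r g h) = qNum r h := by
  obtain ⟨x₀, x₁, x₂, x₃, rfl⟩ := cls_surjective r h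
  obtain ⟨c, hc⟩ := exists_half g.1.2
  obtain ⟨c', hc'⟩ := exists_half (g.2⁻¹).2
  have d1 := Matrix.det_fin_two (g.1 : SL(2, ℤ)).1
  have d2 := Matrix.det_fin_two ((g.2⁻¹ : G2) : SL(2, ℤ)).1
  rw [Matrix.SpecialLinearGroup.det_coe] at d1 d2
  change 1 = (g.1 : SL(2, ℤ)) 0 0 * (g.1 : SL(2, ℤ)) 1 1
    - (g.1 : SL(2, ℤ)) 0 1 * (g.1 : SL(2, ℤ)) 1 0 at d1
  change 1 = ((g.2⁻¹ : G2) : SL(2, ℤ)) 0 0 * ((g.2⁻¹ : G2) : SL(2, ℤ)) 1 1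
    - ((g.2⁻¹ : G2) : SL(2, ℤ)) 0 1 * ((g.2⁻¹ : G2) : SL(2, ℤ)) 1 0 at d2
  rw [hc] at d1
  rw [hc'] at d2
  rw [soAct_apply, actR_cls r hc', actL_cls r hc, qNum_cls, qNum_cls]
  congr 1
  generalize (g.1 : SL(2, ℤ)) 0 0 = a at *
  generalize (g.1 : SL(2, ℤ)) 0 1 = b at *
  generalize (g.1 : SL(2, ℤ)) 1 1 = d at *
  generalize ((g.2⁻¹ : G2) : SL(2, ℤ)) 0 0 = a' at *
  generalize ((g.2⁻¹ : G2) : SL(2, ℤ)) 0 1 = b' at *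
  generalize ((g.2⁻¹ : G2) : SL(2, ℤ)) 1 1 = d' at *
  linear_combination (-(2 * (x₀ * x₃) - x₁ * x₂) * (a' * d' - b' * (2 * c'))) * d1
    - (2 * (x₀ * x₃) - x₁ * x₂) * d2

/-- The matrix `B = S T² S⁻¹ = (1, 0; -2, 1)`. -/
def matB : SL(2, ℤ) := ModularGroup.S * ModularGroup.T ^ 2 * ModularGroup.S⁻¹

/-- `Γ_{χ,r}`, generated by the derived subgroup of `Γ₀(2)`, by `T²⁴`, `S²`, `TB`, and by `Tʳ`. -/
def GammaChi (r : ℕ) : Subgroup SL(2, ℤ) :=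
  ⁅G2, G2⁆ ⊔ Subgroup.closure {ModularGroup.T ^ 24, ModularGroup.S ^ 2, ModularGroup.T * matB,
    ModularGroup.T ^ r}

/-- `T` as an element of `Γ₀(2)`. -/
def T2 : G2 := ⟨ModularGroup.T, by simp [CongruenceSubgroup.Gamma0_mem, ModularGroup.coe_T]⟩

/-- The group `H'_r`: the image of the subgroup of `SO(L_r) = Γ₀(2) × Γ₀(2)` generated by `(T, T)`
and `Γ_{χ,r} × Γ_{χ,r}` in `SO(L_r)/Γ_{L_r}`, where `Γ_{L_r}` is the kernel of the action
on `L_r'/L_r`, so that the quotient is a group of automorphisms of `L_r'/L_r`. -/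
def Hprime (r : ℕ) : Subgroup (Equiv.Perm (Disc r)) :=
  (Subgroup.zpowers (T2, T2) ⊔
    ((GammaChi r).subgroupOf G2).prod ((GammaChi r).subgroupOf G2)).map (soAct r)

/-- The `H'_r`-invariants in `U_r`, where `φ ∈ H'_r` acts by `𝔢_h ↦ 𝔢_{φ h}`. -/
def invariants (r : ℕ) : Submodule ℂ (U r) where
  carrier := {f | ∀ φ ∈ Hprime r, (fun h => f (φ⁻¹ h)) = f}
  zero_mem' := fun _ _ => rfl
  add_mem' := fun {f g} hf hg φ hφ => by
    have h1 := hf φ hφ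
    have h2 := hg φ hφ
    funext h
    exact congrArg₂ (· + ·) (congrFun h1 h) (congrFun h2 h)
  smul_mem' := fun c f hf φ hφ => by
    have h1 := hf φ hφ
    funext h
    exact congrArg (c * ·) (congrFun h1 h)

/-! ### The vectors `u_r`, `v_r`, `w_r` and the embedding -/

/-- `κ_r : L_r → L_r'/L_r`, `λ ↦ λ/r + L_r`, on `Γ₀(2) ⊂ L_r`. -/
def kappa (r : ℕ) (g : SL(2, ℤ)) : Disc r := cls r (g 0 0) (2 * g 0 1) (g 1 0) (g 1 1)

theorem kappa_spec (r : ℕ) (g : SL(2, ℤ)) :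
    dualVec r (g 0 0) (2 * g 0 1) (g 1 0) (g 1 1) =
      (1 / (r : ℚ)) • g.1.map (Int.cast : ℤ → ℚ) := by
  ext i j; fin_cases i <;> fin_cases j <;> simp [dualVec]

/-- `κ_r(T^j Γ_{χ,r})` for `j ∈ ℤ/r`. -/
def kappaCoset (r : ℕ) (j : ZMod r) : Set (Disc r) :=
  {h | ∃ γ ∈ GammaChi r, h = kappa r (ModularGroup.T ^ j.val * γ)}

/-- `a_r(j) = ∑_{s ∈ (ℤ/r)ˣ} ζ_r^{sj}`. -/
def coeffA (r : ℕ) [NeZero r] (j : ZMod r) : ℂ := ∑ s : (ZMod r)ˣ, ZMod.stdAddChar ((s : ZMod r) * j)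

/-- `u_r = ∑_j a_r(j) ∑_{h ∈ κ_r(T^j Γ_{χ,r})} 𝔢_h`; the inner sum is an indicator function. -/
def vecU (r : ℕ) [NeZero r] : U r :=
  ∑ j : ZMod r, coeffA r j • (kappaCoset r j).indicator (fun _ => (1 : ℂ))

/-- `v_r = ω_r(S) u_r`. -/
def vecV (r : ℕ) [NeZero r] : U r := weilRep r ModularGroup.S (vecU r)

/-- `w_r = ζ_{2r}⁻¹ ω_r(T) v_r`. -/
def vecW (r : ℕ) [NeZero r] : U r := (zeta (2 * r))⁻¹ • weilRep r ModularGroup.T (vecV r)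

/-- `ι_r(a, b, c) = a u_r + b v_r + c w_r`. -/
def iota (r : ℕ) [NeZero r] : (Fin 3 → ℂ) →ₗ[ℂ] U r where
  toFun x := x 0 • vecU r + x 1 • vecV r + x 2 • vecW r
  map_add' x y := by simp only [Pi.add_apply, add_smul]; abel
  map_smul' c x := by simp only [Pi.smul_apply, smul_eq_mul, mul_smul, smul_add, RingHom.id_apply]

/-! ### Weber functions and weakly holomorphic vector-valued modular functions -/

/-- `𝔣(τ) = ζ₄₈⁻¹ η((τ+1)/2) / η(τ)`. -/
def weberF (τ : ℍ) : ℂ := (zeta 48)⁻¹ * (ModularForm.eta (((τ : ℂ) + 1) / 2) / ModularForm.eta τ)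

/-- `𝔣₁(τ) = η(τ/2) / η(τ)`. -/
def weberF1 (τ : ℍ) : ℂ := ModularForm.eta ((τ : ℂ) / 2) / ModularForm.eta τ

/-- `𝔣₂(τ) = √2 η(2τ) / η(τ)`. -/
def weberF2 (τ : ℍ) : ℂ := (Real.sqrt 2 : ℂ) * (ModularForm.eta (2 * (τ : ℂ)) / ModularForm.eta τ)

/-- `F_r = √2^{24/r} (𝔣₂^{-24/r}, 𝔣₁^{-24/r}, 𝔣^{-24/r})` for `r ∣ 24`. -/
def weberVec (r : ℕ) (τ : ℍ) : Fin 3 → ℂ :=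
  ((Real.sqrt 2 : ℂ) ^ (24 / r)) •
    ![(weberF2 τ ^ (24 / r))⁻¹, (weberF1 τ ^ (24 / r))⁻¹, (weberF τ ^ (24 / r))⁻¹]

/-- `f ∈ M^!(ρ)`: `f` is holomorphic on the upper half plane, satisfies `f(γτ) = ρ(γ) f(τ)` for
all `γ ∈ SL(2, ℤ)`, and is meromorphic at the cusp, that is, a meromorphic function at `0` of
the local parameter `q^{1/N} = e^{2πiτ/N}` for some `N ≥ 1`. -/
structure IsWeaklyHolomorphic {V : Type*} [NormedAddCommGroup V] [NormedSpace ℂ V]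
    (ρ : Representation ℂ SL(2, ℤ) V) (f : ℍ → V) : Prop where
  holo : MDifferentiable 𝓘(ℂ) 𝓘(ℂ, V) f
  modular : ∀ (γ : SL(2, ℤ)) (τ : ℍ), f (γ • τ) = ρ γ (f τ)
  cusp : ∃ N : ℕ, 0 < N ∧ ∃ g : ℂ → V, MeromorphicAt g 0 ∧
    ∀ᶠ τ : ℍ in atImInfty, f τ = g (Complex.exp (2 * Real.pi * Complex.I * τ / N))

end WeberWeil

end

open WeberWeil

open scoped MatrixGroups Manifold Asymptotics
open UpperHalfPlane

noncomputable section

namespace WeberWeil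

/-! ### The cosets of `Γ_{χ,r}` -/

section Cosets

/-! The proof rests on splitting `u_r` into the functions `twist r s`, for units `s` of `ℤ/r`. Each
is an eigenfunction of the action: a pair `(g₁, g₂)` with `g₁ g₂⁻¹ ∈ T^m Γ_{χ,r}` shifts the coset
index `j` by `m` and so contributes the factor `ζ_r^{sm}`. On `H'_r` one can take `m = 0`, which
gives invariance of `u_r`. The action preserves `Q_r`, hence commutes with `ω_r`, and so `v_r` and
`w_r` are invariant too.

Since `S` and `T` generate, equivariance is a matter of their action on the three vectors. On the
support of `u_r`, `Q_r = det / r = 1/r`, so `T` acts there by `ζ_r⁻¹`. The element `S²` acts by `h ↦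
-h`, which is the action of `S² ∈ Γ_{χ,r}`, so `S` exchanges `u_r` and `v_r`. The crux is `T² v_r =
ζ_r v_r`, that is, `v_r` is supported on `Q_r ≡ -1/2r` modulo `1/2`. This follows from the
eigenfunction property alone together with a vanishing for even `r` (`dvd_of_eigenfunction_ne_zero`,
`weilS_twist_eq_zero`), and uses that units modulo a divisor of `24` square to `1`. Finally the
relation `TSTST = S` applied to `u_r` forces `S w_r = w_r`.

For injectivity, `v_r` and `w_r` take equal values at `κ_r(1)` and at its translate by `[0, r, 0,
0]`, while `u_r` does not. This requires that `κ_r(1)` lie in the coset `j = 0` only, which is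
detected by the explicit character of `η(2τ)/η(τ)` on `Γ₀(2)`.

On the analytic side, `F_r` transforms under `ϱ_r` by the behaviour of `η` under `T` and `S` and the
identity `𝔣 𝔣₁ 𝔣₂ = √2`. The expansion is read off from Euler products in `t = q^{1/48}`. -/

theorem T_mem_G2 : ModularGroup.T ∈ G2 := T2.2

theorem S_sq_mem_G2 : ModularGroup.S ^ 2 ∈ G2 := by
  simp [CongruenceSubgroup.Gamma0_mem, pow_two, mul_entry, ModularGroup.coe_S]

theorem matB_apply : (matB : Matrix (Fin 2) (Fin 2) ℤ) = !![1, 0; -2, 1] := by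
  simp only [matB, Matrix.SpecialLinearGroup.coe_mul, Matrix.SpecialLinearGroup.coe_pow,
    ModularGroup.coe_S, ModularGroup.coe_T, Matrix.SpecialLinearGroup.coe_inv]
  ext i j; fin_cases i <;> fin_cases j <;>
    simp [Matrix.mul_apply, Fin.sum_univ_two, pow_two, Matrix.adjugate_fin_two]

theorem matB_mem_G2 : matB ∈ G2 := by
  rw [CongruenceSubgroup.Gamma0_mem]
  change (((matB : Matrix (Fin 2) (Fin 2) ℤ) 1 0 : ℤ) : ZMod 2) = 0
  rw [matB_apply]; decide

/-- `B` as an element of `Γ₀(2)`. -/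
def B2 : G2 := ⟨matB, matB_mem_G2⟩

theorem GammaChi_le (r : ℕ) : GammaChi r ≤ G2 := by
  refine sup_le (Subgroup.commutator_le.mpr fun a ha b hb =>
    mul_mem (mul_mem (mul_mem ha hb) (inv_mem ha)) (inv_mem hb)) ?_
  rw [Subgroup.closure_le]
  rintro g (rfl | rfl | rfl | rfl)
  · exact pow_mem T_mem_G2 _
  · exact S_sq_mem_G2
  · exact mul_mem T_mem_G2 matB_mem_G2
  · exact pow_mem T_mem_G2 _

theorem T_pow_mem_GammaChi (r : ℕ) : ModularGroup.T ^ r ∈ GammaChi r :=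
  le_sup_right (a := ⁅G2, G2⁆) (Subgroup.subset_closure (by simp))

theorem T_mul_matB_mem_GammaChi (r : ℕ) : ModularGroup.T * matB ∈ GammaChi r :=
  le_sup_right (a := ⁅G2, G2⁆) (Subgroup.subset_closure (by simp))

/-- Membership in `Γ_{χ,r}` only depends on the class modulo commutators. -/
theorem mem_GammaChi_iff_of_abelianization (r : ℕ) {x y : G2}
    (h : Abelianization.of x = Abelianization.of y) :
    (x : SL(2, ℤ)) ∈ GammaChi r ↔ (y : SL(2, ℤ)) ∈ GammaChi r := by
  have h1 : x⁻¹ * y ∈ commutator G2 := by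
    rw [← Abelianization.ker_of, MonoidHom.mem_ker, map_mul, map_inv, h, inv_mul_cancel]
  have h2 : ((x⁻¹ * y : G2) : SL(2, ℤ)) ∈ GammaChi r := by
    apply le_sup_left (a := ⁅G2, G2⁆)
    rw [← Subgroup.map_subtype_commutator]
    exact Subgroup.mem_map_of_mem _ h1
  rw [Subgroup.coe_mul, Subgroup.coe_inv] at h2
  exact ⟨fun hx => by simpa using mul_mem hx h2, fun hy => by
    simpa using mul_mem hy (inv_mem h2)⟩

/-- As `T^r ∈ Γ_{χ,r}`, the representative `j.val` may be replaced by any integer, so that indices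
can be added without reduction. -/
theorem mem_kappaCoset_iff (r : ℕ) [NeZero r] (j : ZMod r) (h : Disc r) (n : ℤ)
    (hn : (n : ZMod r) = j) :
    h ∈ kappaCoset r j ↔ ∃ γ ∈ GammaChi r, h = kappa r (ModularGroup.T ^ n * γ) := by
  have h1 : ((n - j.val : ℤ) : ZMod r) = 0 := by simp [hn]
  rw [ZMod.intCast_zmod_eq_zero_iff_dvd] at h1
  obtain ⟨k, hk⟩ := h1
  have hT : ModularGroup.T ^ (r * k : ℤ) ∈ GammaChi r := by
    rw [zpow_mul, zpow_natCast]; exact zpow_mem (T_pow_mem_GammaChi r) k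
  obtain rfl : n = j.val + r * k := by linarith
  constructor
  · rintro ⟨γ, hγ, rfl⟩
    refine ⟨(ModularGroup.T ^ (r * k : ℤ))⁻¹ * γ, mul_mem (inv_mem hT) hγ, ?_⟩
    rw [zpow_add, zpow_natCast]; group
  · rintro ⟨γ, hγ, rfl⟩
    refine ⟨ModularGroup.T ^ (r * k : ℤ) * γ, mul_mem hT hγ, ?_⟩
    rw [zpow_add, zpow_natCast]; group

theorem actL_kappa (r : ℕ) {g : SL(2, ℤ)} (hg : g ∈ G2) (g' : SL(2, ℤ)) :
    actL r g (kappa r g') = kappa r (g * g') := by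
  obtain ⟨c, hc⟩ := exists_half hg
  rw [kappa, actL_cls r hc, kappa]
  simp only [mul_entry, hc]
  congr 1 <;> ring

theorem actR_kappa (r : ℕ) {g : SL(2, ℤ)} (hg : g ∈ G2) (g' : SL(2, ℤ)) :
    actR r g (kappa r g') = kappa r (g' * g) := by
  obtain ⟨c, hc⟩ := exists_half hg
  rw [kappa, actR_cls r hc, kappa]
  simp only [mul_entry, hc]
  congr 1 <;> ring

theorem soAct_kappa (r : ℕ) (g : G2 × G2) (x : SL(2, ℤ)) :
    soAct r g (kappa r x) = kappa r (g.1 * x * (g.2 : SL(2, ℤ))⁻¹) := by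
  rw [soAct_apply, actR_kappa r (g.2⁻¹).2, actL_kappa r g.1.2, mul_assoc]; rfl

/-- `(g₁, g₂)` shifts the coset index by the class of `g₁ g₂⁻¹`. -/
theorem soAct_mem_kappaCoset (r : ℕ) [NeZero r] (g : G2 × G2) (m : ℤ)
    (hm : ((T2 ^ m)⁻¹ * (g.1 * g.2⁻¹) : G2).1 ∈ GammaChi r) (j : ZMod r) {h : Disc r}
    (hh : h ∈ kappaCoset r j) : soAct r g h ∈ kappaCoset r (j + m) := by
  obtain ⟨n, rfl⟩ := ZMod.intCast_surjective j
  rw [mem_kappaCoset_iff r _ h n rfl] at hh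
  rw [mem_kappaCoset_iff r _ _ (n + m) (by push_cast; rfl)]
  obtain ⟨γ, hγ, rfl⟩ := hh
  -- Modulo commutators this element is `(T^{-m} g₁ g₂⁻¹) γ`, a product of two elements of
  -- `Γ_{χ,r}`.
  refine ⟨((T2 ^ (n + m))⁻¹ * (g.1 * (T2 ^ n * ⟨γ, GammaChi_le r hγ⟩) * g.2⁻¹) : G2), ?_, ?_⟩
  · rw [mem_GammaChi_iff_of_abelianization r
      (y := ((T2 ^ m)⁻¹ * (g.1 * g.2⁻¹)) * ⟨γ, GammaChi_le r hγ⟩)]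
    · exact mul_mem hm hγ
    · simp only [map_mul, map_inv, map_zpow, zpow_add]
      generalize Abelianization.of T2 = t
      have (a b c d e : Abelianization G2) : (a * b)⁻¹ * (c * (a * d) * e) = b⁻¹ * (c * e) * d := by
        rw [mul_inv_rev]
        calc b⁻¹ * a⁻¹ * (c * (a * d) * e) = b⁻¹ * (a⁻¹ * a) * (c * e) * d := by
              simp only [mul_assoc, mul_left_comm, mul_comm]
          _ = _ := by simp
      exact this _ _ _ _ _
  · rw [soAct_kappa]
    congr 1
    simp only [Subgroup.coe_mul, Subgroup.coe_inv, Subgroup.coe_zpow, T2]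
    group

theorem soAct_mem_kappaCoset_iff (r : ℕ) [NeZero r] (g : G2 × G2) (m : ℤ)
    (hm : ((T2 ^ m)⁻¹ * (g.1 * g.2⁻¹) : G2).1 ∈ GammaChi r) (j : ZMod r) (h : Disc r) :
    soAct r g h ∈ kappaCoset r (j + m) ↔ h ∈ kappaCoset r j := by
  refine ⟨fun hh => ?_, soAct_mem_kappaCoset r g m hm j⟩
  have h1 : ((T2 ^ (-m))⁻¹ * (g⁻¹.1 * g⁻¹.2⁻¹) : G2).1 ∈ GammaChi r := by
    rw [mem_GammaChi_iff_of_abelianization r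
      (y := ((T2 ^ m)⁻¹ * (g.1 * g.2⁻¹))⁻¹)]
    · exact inv_mem hm
    · simp only [map_mul, map_inv, map_zpow, Prod.fst_inv, Prod.snd_inv, mul_inv_rev, inv_inv,
        zpow_neg]
      simp only [mul_left_comm, mul_comm]
  have h2 := soAct_mem_kappaCoset r g⁻¹ (-m) h1 _ hh
  rw [← Equiv.Perm.mul_apply, ← map_mul, inv_mul_cancel, map_one, Equiv.Perm.one_apply] at h2
  simpa using h2

end Cosets

/-! ### The isotypic components of `u_r` -/

section Twist

/-- `∑_j ζ_r^{sj} ∑_{h ∈ κ_r(T^j Γ_{χ,r})} 𝔢_h`. -/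
def twist (r : ℕ) [NeZero r] (s : ZMod r) : U r :=
  ∑ j : ZMod r, ZMod.stdAddChar (s * j) • (kappaCoset r j).indicator (fun _ => (1 : ℂ))

/-- The sum defining `coeffA` is exchanged with the sum over cosets. In general only the summands
are eigenfunctions of `(T, 1)`, so properties of `u_r` are proved for each `s` separately. -/
theorem vecU_eq_sum_twist (r : ℕ) [NeZero r] : vecU r = ∑ s : (ZMod r)ˣ, twist r s := by
  simp only [vecU, coeffA, twist, Finset.sum_smul]
  exact Finset.sum_comm

theorem twist_apply (r : ℕ) [NeZero r] (s : ZMod r) (h : Disc r) :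
    twist r s h = ∑ j : ZMod r, ZMod.stdAddChar (s * j) *
      (kappaCoset r j).indicator (fun _ => (1 : ℂ)) h := by
  simp [twist, Finset.sum_apply]

/-- Substituting `j + m` for `j` pulls the constant `ζ_r^{sm}` out of the sum over cosets. -/
theorem twist_soAct (r : ℕ) [NeZero r] (s : ZMod r) (g : G2 × G2) (m : ℤ)
    (hm : ((T2 ^ m)⁻¹ * (g.1 * g.2⁻¹) : G2).1 ∈ GammaChi r) (h : Disc r) :
    twist r s (soAct r g h) = ZMod.stdAddChar (s * (m : ZMod r)) * twist r s h := by
  classical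
  rw [twist_apply, twist_apply, Finset.mul_sum, ← Equiv.sum_comp (Equiv.addRight (m : ZMod r))]
  refine Finset.sum_congr rfl fun j _ => ?_
  simp only [Equiv.coe_addRight, Set.indicator_apply, soAct_mem_kappaCoset_iff r g m hm]
  rw [mul_add, AddChar.map_add_eq_mul]
  ring

theorem exists_kappa_of_twist_ne_zero (r : ℕ) [NeZero r] (s : ZMod r) {h : Disc r}
    (hh : twist r s h ≠ 0) : ∃ g ∈ G2, h = kappa r g := by
  rw [twist_apply] at hh
  obtain ⟨j, -, hj⟩ := Finset.exists_ne_zero_of_sum_ne_zero hh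
  obtain ⟨γ, hγ, rfl⟩ := Set.mem_of_indicator_ne_zero (right_ne_zero_of_mul hj)
  exact ⟨_, mul_mem (pow_mem T_mem_G2 _) (GammaChi_le r hγ), rfl⟩

theorem bNum_soAct (r : ℕ) (g : G2 × G2) (h k : Disc r) :
    bNum r (soAct r g h) (soAct r g k) = bNum r h k := by
  simp only [bNum, ← soAct_add, qNum_soAct]

/-- `ω_r(S)` preserves eigenvectors of the action of `Γ₀(2) × Γ₀(2)`. -/
theorem weilS_soAct (r : ℕ) [NeZero r] (g : G2 × G2) (c : ℂ) (f : U r)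
    (hf : ∀ k, f (soAct r g k) = c * f k) (h : Disc r) :
    weilS r f (soAct r g h) = c * weilS r f h := by
  simp only [weilS, LinearMap.coe_mk, AddHom.coe_mk]
  rw [← Equiv.sum_comp (soAct r g)]
  simp only [bNum_soAct, hf, Finset.mul_sum]
  exact Finset.sum_congr rfl fun _ _ => by ring

theorem weilT_soAct (r : ℕ) [NeZero r] (g : G2 × G2) (c : ℂ) (f : U r)
    (hf : ∀ k, f (soAct r g k) = c * f k) (h : Disc r) :
    weilT r f (soAct r g h) = c * weilT r f h := by
  simp only [weilT, LinearMap.coe_mk, AddHom.coe_mk, qNum_soAct, hf]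
  ring

theorem mem_invariants_iff (r : ℕ) (f : U r) : f ∈ invariants r ↔
    ∀ g ∈ Subgroup.zpowers (T2, T2) ⊔
      ((GammaChi r).subgroupOf G2).prod ((GammaChi r).subgroupOf G2),
      ∀ h, f (soAct r g h) = f h := by
  change (∀ φ ∈ Hprime r, (fun h => f (φ⁻¹ h)) = f) ↔ _
  constructor
  · intro H g hg h
    have := congrFun (H (soAct r g)⁻¹ (inv_mem (Subgroup.mem_map_of_mem _ hg))) h
    simpa using this
  · rintro H φ ⟨g, hg, rfl⟩
    funext h
    have := H g hg ((soAct r g)⁻¹ h)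
    rw [← Equiv.Perm.mul_apply, mul_inv_cancel, Equiv.Perm.one_apply] at this
    exact this.symm

/-- `Γ_{χ,r}` contains the commutators, hence is normal in `Γ₀(2)`. The pairs whose components agree
in the quotient form a subgroup, which contains `(T, T)` and `Γ_{χ,r} × Γ_{χ,r}`. -/
theorem mul_inv_mem_GammaChi (r : ℕ) (g : G2 × G2) (hg : g ∈ Subgroup.zpowers (T2, T2) ⊔
      ((GammaChi r).subgroupOf G2).prod ((GammaChi r).subgroupOf G2)) :
    (g.1 * g.2⁻¹ : G2).1 ∈ GammaChi r := by
  have hn : ((GammaChi r).subgroupOf G2).Normal := by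
    refine ⟨fun n hn g => ?_⟩
    rw [Subgroup.mem_subgroupOf] at hn ⊢
    rw [mem_GammaChi_iff_of_abelianization r (y := n)]
    · exact hn
    · simp [mul_comm]
  let π := QuotientGroup.mk' ((GammaChi r).subgroupOf G2)
  suffices h : Subgroup.zpowers (T2, T2) ⊔
      ((GammaChi r).subgroupOf G2).prod ((GammaChi r).subgroupOf G2) ≤
      (π.comp (MonoidHom.fst G2 G2)).eqLocus (π.comp (MonoidHom.snd G2 G2)) by
    have h1 : π g.1 = π g.2 := h hg
    have h2 : π (g.1 * g.2⁻¹) = 1 := by rw [map_mul, map_inv, h1, mul_inv_cancel]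
    exact Subgroup.mem_subgroupOf.mp ((QuotientGroup.eq_one_iff _).mp h2)
  refine sup_le ?_ ?_
  · rw [Subgroup.zpowers_le]; rfl
  · rintro ⟨a, b⟩ ⟨ha, hb⟩
    exact ((QuotientGroup.eq_one_iff a).mpr ha).trans ((QuotientGroup.eq_one_iff b).mpr hb).symm

theorem vecU_mem_invariants (r : ℕ) [NeZero r] : vecU r ∈ invariants r := by
  rw [vecU_eq_sum_twist]
  refine Submodule.sum_mem _ fun s _ => (mem_invariants_iff r _).mpr fun g hg h => ?_
  rw [twist_soAct r s g 0 (by simpa using mul_inv_mem_GammaChi r g hg)]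
  simp

theorem weilS_mem_invariants (r : ℕ) [NeZero r] {f : U r} (hf : f ∈ invariants r) :
    weilS r f ∈ invariants r := by
  rw [mem_invariants_iff] at hf ⊢
  intro g hg h
  rw [weilS_soAct r g 1 f (fun k => by rw [hf g hg, one_mul]), one_mul]

theorem weilT_mem_invariants (r : ℕ) [NeZero r] {f : U r} (hf : f ∈ invariants r) :
    weilT r f ∈ invariants r := by
  rw [mem_invariants_iff] at hf ⊢
  intro g hg h
  rw [weilT_soAct r g 1 f (fun k => by rw [hf g hg, one_mul]), one_mul]

theorem iota_mem_invariants (r : ℕ) [NeZero r] (x : Fin 3 → ℂ) : iota r x ∈ invariants r := by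
  have hV : vecV r ∈ invariants r := by
    rw [vecV, weilRep_S]; exact weilS_mem_invariants r (vecU_mem_invariants r)
  have hW : vecW r ∈ invariants r := by
    rw [vecW, weilRep_T]; exact Submodule.smul_mem _ _ (weilT_mem_invariants r hV)
  exact add_mem (add_mem (Submodule.smul_mem _ _ (vecU_mem_invariants r))
    (Submodule.smul_mem _ _ hV)) (Submodule.smul_mem _ _ hW)

end Twist

/-! ### The support of `ω_r(S) u_r` -/

section Support

theorem cls_congr (r : ℕ) {x₀ x₁ x₂ x₃ y₀ y₁ y₂ y₃ : ℤ} (h0 : (r : ℤ) ∣ x₀ - y₀)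
    (h1 : (2 * r : ℤ) ∣ x₁ - y₁) (h2 : (2 * r : ℤ) ∣ x₂ - y₂) (h3 : (r : ℤ) ∣ x₃ - y₃) :
    cls r x₀ x₁ x₂ x₃ = cls r y₀ y₁ y₂ y₃ := by
  have e : ∀ (m : ℕ) (x y : ℤ), (m : ℤ) ∣ x - y → (x : ZMod m) = y := fun m x y h => by
    rw [eq_comm, ZMod.intCast_eq_intCast_iff_dvd_sub]; exact h
  simp only [cls, Prod.mk.injEq]
  exact ⟨e _ _ _ h0, e _ _ _ (by push_cast; exact h1), e _ _ _ (by push_cast; exact h2),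
    e _ _ _ h3⟩

theorem soAct_left_T (r : ℕ) (x₀ x₁ x₂ x₃ : ℤ) :
    soAct r (T2, 1) (cls r x₀ x₁ x₂ x₃) = cls r (x₀ + x₂) (x₁ + 2 * x₃) x₂ x₃ := by
  have hc : ModularGroup.T 1 0 = 2 * (0 : ℤ) := by simp [ModularGroup.coe_T]
  rw [soAct_apply, inv_one, Subgroup.coe_one, actR_one]
  change actL r ModularGroup.T _ = _
  rw [actL_cls r hc]
  simp [ModularGroup.coe_T]

theorem soAct_right_T (r : ℕ) (x₀ x₁ x₂ x₃ : ℤ) :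
    soAct r (1, T2⁻¹) (cls r x₀ x₁ x₂ x₃) = cls r x₀ (2 * x₀ + x₁) x₂ (x₂ + x₃) := by
  have hc : ModularGroup.T 1 0 = 2 * (0 : ℤ) := by simp [ModularGroup.coe_T]
  rw [soAct_apply, inv_inv, Subgroup.coe_one, actL_one]
  change actR r ModularGroup.T _ = _
  rw [actR_cls r hc]
  simp [ModularGroup.coe_T]

theorem matB_adjugate : (matB : Matrix (Fin 2) (Fin 2) ℤ).adjugate = !![1, 0; 2, 1] := by
  rw [matB_apply, Matrix.adjugate_fin_two_of]
  simp

theorem soAct_left_B (r : ℕ) (x₀ x₁ x₂ x₃ : ℤ) :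
    soAct r (B2⁻¹, 1) (cls r x₀ x₁ x₂ x₃) = cls r x₀ x₁ (2 * x₀ + x₂) (x₁ + x₃) := by
  have hc : (matB⁻¹ : SL(2, ℤ)) 1 0 = 2 * (1 : ℤ) := by simp [matB_adjugate]
  rw [soAct_apply, inv_one, Subgroup.coe_one, actR_one]
  change actL r matB⁻¹ _ = _
  rw [actL_cls r hc]
  simp [matB_adjugate]

theorem soAct_right_B (r : ℕ) (x₀ x₁ x₂ x₃ : ℤ) :
    soAct r (1, B2) (cls r x₀ x₁ x₂ x₃) = cls r (x₀ + x₁) x₁ (x₂ + 2 * x₃) x₃ := by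
  have hc : (matB⁻¹ : SL(2, ℤ)) 1 0 = 2 * (1 : ℤ) := by simp [matB_adjugate]
  rw [soAct_apply, Subgroup.coe_one, actL_one]
  change actR r matB⁻¹ _ = _
  rw [actR_cls r hc]
  simp [matB_adjugate]

/-- The characteristic property of the divisors of `24`, checked for each of the eight. -/
theorem sq_modEq_one_of_isCoprime {r : ℕ} (hr : r ∣ 24) {x : ℤ} (hx : IsCoprime x r) :
    (r : ℤ) ∣ x ^ 2 - 1 := by
  have hu : IsUnit (x : ZMod r) := by
    obtain ⟨a, b, hab⟩ := hx
    have := congrArg (Int.cast : ℤ → ZMod r) hab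
    push_cast at this
    rw [ZMod.natCast_self, mul_zero, add_zero] at this
    exact IsUnit.of_mul_eq_one _ (by rw [mul_comm]; exact this)
  have key : ∀ y z : ZMod r, y * z = 1 → y ^ 2 = 1 := by
    have : r ∈ Nat.divisors 24 := by simp [hr]
    have h24 : Nat.divisors 24 = {1, 2, 3, 4, 6, 8, 12, 24} := by decide
    rw [h24] at this
    simp only [Finset.mem_insert, Finset.mem_singleton] at this
    rcases this with rfl | rfl | rfl | rfl | rfl | rfl | rfl | rfl <;> decide
  obtain ⟨u, hu⟩ := hu
  have h1 := key x (u⁻¹ : (ZMod r)ˣ) (by rw [← hu, Units.mul_inv])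
  rw [← ZMod.intCast_zmod_eq_zero_iff_dvd]
  push_cast
  rw [h1, sub_self]

theorem isCoprime_of_dvd_twentyFour {r : ℕ} (hr : r ∣ 24) {x : ℤ} (h2 : 2 ∣ r → ¬ (2 : ℤ) ∣ x)
    (h3 : 3 ∣ r → ¬ (3 : ℤ) ∣ x) : IsCoprime x r := by
  rw [Int.isCoprime_iff_gcd_eq_one]
  by_contra h
  obtain ⟨p, hp, hpd⟩ := Nat.exists_prime_and_dvd h
  have hpx : (p : ℤ) ∣ x := (Int.natCast_dvd_natCast.mpr hpd).trans (Int.gcd_dvd_left ..)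
  have hpr : p ∣ r := by
    exact_mod_cast (Int.natCast_dvd_natCast.mpr hpd).trans (Int.gcd_dvd_right ..)
  have h24 : p ∣ 2 ^ 3 * 3 := hpr.trans hr
  rcases (Nat.Prime.dvd_mul hp).mp h24 with h | h
  · have := (Nat.prime_dvd_prime_iff_eq hp Nat.prime_two).mp (hp.dvd_of_dvd_pow h)
    subst this
    exact h2 hpr hpx
  · have := (Nat.prime_dvd_prime_iff_eq hp Nat.prime_three).mp h
    subst this
    exact h3 hpr hpx

theorem exists_natCast_mul_modEq {r : ℕ} [NeZero r] {x : ℤ} (hx : IsCoprime x r) (y : ℤ) :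
    ∃ n : ℕ, (r : ℤ) ∣ n * x - y := by
  obtain ⟨a, b, hab⟩ := hx
  have hr : (0 : ℤ) < r := by exact_mod_cast NeZero.pos r
  -- `a` is an inverse of `x` modulo `r`; the residue is taken to get a nonnegative exponent.
  refine ⟨((y * a) % r).toNat, ?_⟩
  rw [Int.toNat_of_nonneg (Int.emod_nonneg _ hr.ne'), Int.emod_def]
  exact ⟨-(y * a / r) * x - y * b, by linear_combination y * hab⟩

/-- A function on `𝒜_r` on which `T` acts from both sides, and `B` inversely, by a primitive `r`-th
root of unity, and which is supported on odd `h₂` if `r` is even, is supported on `Q_r = -1/2r`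
modulo `1/2`. -/
theorem dvd_of_eigenfunction_ne_zero {r : ℕ} [NeZero r] (hr : r ∣ 24) (f : U r) (z : ℂ)
    (hz : IsPrimitiveRoot z r)
    (hTl : ∀ x₀ x₁ x₂ x₃ : ℤ,
      f (cls r (x₀ + x₂) (x₁ + 2 * x₃) x₂ x₃) = z * f (cls r x₀ x₁ x₂ x₃))
    (hTr : ∀ x₀ x₁ x₂ x₃ : ℤ,
      f (cls r x₀ (2 * x₀ + x₁) x₂ (x₂ + x₃)) = z * f (cls r x₀ x₁ x₂ x₃))
    (hBl : ∀ x₀ x₁ x₂ x₃ : ℤ,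
      f (cls r x₀ x₁ (2 * x₀ + x₂) (x₁ + x₃)) = z * f (cls r x₀ x₁ x₂ x₃))
    (hBr : ∀ x₀ x₁ x₂ x₃ : ℤ,
      f (cls r (x₀ + x₁) x₁ (x₂ + 2 * x₃) x₃) = z * f (cls r x₀ x₁ x₂ x₃))
    (hodd : 2 ∣ r → ∀ x₀ x₁ x₂ x₃ : ℤ, 2 ∣ x₂ → f (cls r x₀ x₁ x₂ x₃) = 0)
    (x₀ x₁ x₂ x₃ : ℤ) (hf : f (cls r x₀ x₁ x₂ x₃) ≠ 0) :
    (r : ℤ) ∣ 2 * (x₀ * x₃) - x₁ * x₂ + 1 := by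
  have hz0 : z ≠ 0 := hz.ne_zero (NeZero.ne r)
  have hTl' : ∀ (n : ℕ) (x₀ x₁ x₂ x₃ : ℤ),
      f (cls r (x₀ + n * x₂) (x₁ + 2 * (n * x₃)) x₂ x₃) = z ^ n * f (cls r x₀ x₁ x₂ x₃) := by
    intro n
    induction n with
    | zero => intros; simp
    | succ n ih =>
      intro x₀ x₁ x₂ x₃
      rw [pow_succ', mul_assoc, ← ih, ← hTl]
      congr 2 <;> push_cast <;> ring
  have hTr' : ∀ (n : ℕ) (x₀ x₁ x₂ x₃ : ℤ),
      f (cls r x₀ (2 * (n * x₀) + x₁) x₂ (n * x₂ + x₃)) = z ^ n * f (cls r x₀ x₁ x₂ x₃) := by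
    intro n
    induction n with
    | zero => intros; simp
    | succ n ih =>
      intro x₀ x₁ x₂ x₃
      rw [pow_succ', mul_assoc, ← ih, ← hTr]
      congr 2 <;> push_cast <;> ring
  -- the case of antidiagonal matrices
  have anti : ∀ x₀ x₁ x₂ x₃ : ℤ, f (cls r x₀ x₁ x₂ x₃) ≠ 0 → IsCoprime x₂ r → (r : ℤ) ∣ x₀ →
      (r : ℤ) ∣ x₃ → (r : ℤ) ∣ 2 * (x₀ * x₃) - x₁ * x₂ + 1 := by
    intro x₀ x₁ x₂ x₃ hf hc h0 h3
    -- With `n x₂ ≡ x₁` and `r ∣ x₃`, applying `T` from the left `n` times and `B⁻¹` from the right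
    -- once lead to the same class. Hence `zⁿ = z`, so `n ≡ 1` and `x₁ ≡ x₂` modulo `r`, and `x₁ x₂
    -- ≡ x₂² ≡ 1`.
    obtain ⟨n, hn⟩ := exists_natCast_mul_modEq hc x₁
    have h1 : z ^ n = z ^ 1 := by
      apply mul_right_cancel₀ hf
      rw [← hTl', pow_one, ← hBr]
      congr 1
      apply cls_congr
      · convert hn using 1; ring
      · rw [add_sub_cancel_left]; exact mul_dvd_mul_left 2 (h3.mul_left _)
      · rw [sub_add_cancel_left, dvd_neg]; exact mul_dvd_mul_left 2 h3
      · simp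
    have h2 : (r : ℤ) ∣ n - 1 := by
      have : z ^ ((n : ℤ) - 1) = 1 := by
        rw [zpow_sub₀ hz0, zpow_natCast, h1, pow_one, zpow_one, div_self hz0]
      exact (hz.zpow_eq_one_iff_dvd _).mp this
    obtain ⟨a, ha⟩ := hn
    obtain ⟨b, hb⟩ := h2
    obtain ⟨c, hc⟩ := sq_modEq_one_of_isCoprime hr hc
    obtain ⟨d, hd⟩ := h0
    exact ⟨2 * (d * x₃) + a * x₂ - b * x₂ ^ 2 - c, by
      linear_combination 2 * x₃ * hd + x₂ * ha - x₂ ^ 2 * hb - hc⟩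
  -- the case of a unit in the lower left corner
  have unit : ∀ x₀ x₁ x₂ x₃ : ℤ, f (cls r x₀ x₁ x₂ x₃) ≠ 0 → IsCoprime x₂ r →
      (r : ℤ) ∣ 2 * (x₀ * x₃) - x₁ * x₂ + 1 := by
    intro x₀ x₁ x₂ x₃ hf hc
    -- Powers of `T` from the left and from the right clear `x₀` and `x₃` modulo `r`. They change
    -- neither the quadratic form nor the nonvanishing of `f`.
    obtain ⟨n, hn⟩ := exists_natCast_mul_modEq hc (-x₀)
    obtain ⟨m, hm⟩ := exists_natCast_mul_modEq hc (-x₃)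
    have h1 := anti (x₀ + n * x₂) (2 * (m * (x₀ + n * x₂)) + (x₁ + 2 * (n * x₃))) x₂
      (m * x₂ + x₃) (by rw [hTr', hTl']; positivity) hc (by convert hn using 1; ring)
      (by convert hm using 1; ring)
    convert h1 using 1
    ring
  have hc2 : ∀ x₀ x₁ x₂ x₃ : ℤ, f (cls r x₀ x₁ x₂ x₃) ≠ 0 → 2 ∣ r → ¬ (2 : ℤ) ∣ x₂ :=
    fun x₀ x₁ x₂ x₃ hf h2 h => hf (hodd h2 x₀ x₁ x₂ x₃ h)
  have red2 : ∀ x₀ x₁ x₂ x₃ : ℤ, f (cls r x₀ x₁ x₂ x₃) ≠ 0 → (3 ∣ r → ¬ (3 : ℤ) ∣ x₂) →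
      (r : ℤ) ∣ 2 * (x₀ * x₃) - x₁ * x₂ + 1 := fun x₀ x₁ x₂ x₃ hf h3 =>
    unit x₀ x₁ x₂ x₃ hf (isCoprime_of_dvd_twentyFour hr (hc2 _ _ _ _ hf) h3)
  have red0 : ∀ x₀ x₁ x₂ x₃ : ℤ, f (cls r x₀ x₁ x₂ x₃) ≠ 0 → (3 : ℤ) ∣ x₂ → ¬ (3 : ℤ) ∣ x₀ →
      (r : ℤ) ∣ 2 * (x₀ * x₃) - x₁ * x₂ + 1 := by
    intro x₀ x₁ x₂ x₃ hf h2 h0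
    -- `B⁻¹` from the left adds `2 x₀` to `x₂` and so makes it prime to `3`.
    have h1 := red2 _ _ _ _ (by rw [hBl x₀ x₁ x₂ x₃]; positivity) (fun _ => by omega)
    convert h1 using 1
    ring
  by_cases h3 : 3 ∣ r
  swap
  · exact red2 x₀ x₁ x₂ x₃ hf fun h => absurd h h3
  by_cases k2 : (3 : ℤ) ∣ x₂
  swap
  · exact red2 x₀ x₁ x₂ x₃ hf fun _ => k2
  by_cases k0 : (3 : ℤ) ∣ x₀
  swap
  · exact red0 x₀ x₁ x₂ x₃ hf k2 k0
  by_cases k3 : (3 : ℤ) ∣ x₃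
  swap
  -- `B⁻¹` from the right adds `2 x₃` to `x₂`, which then is prime to `3`.
  · have h1 := red2 _ _ _ _ (by rw [hBr x₀ x₁ x₂ x₃]; positivity) (fun _ => by omega)
    convert h1 using 1
    ring
  by_cases k1 : (3 : ℤ) ∣ x₁
  swap
  -- `B⁻¹` from the right adds `x₁` to `x₀` and keeps the lower left entry divisible by `3`.
  · have h1 := red0 _ _ _ _ (by rw [hBr x₀ x₁ x₂ x₃]; positivity) (by omega) (by omega)
    convert h1 using 1
    ring
  -- All entries are divisible by `3`. Then `T^{r/3}` from the left fixes the class, although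
  -- `z^{r/3} ≠ 1` by primitivity, so `f` would vanish there.
  exfalso
  obtain ⟨m, rfl⟩ := h3
  have h1 : z ^ m = 1 := by
    apply mul_right_cancel₀ hf
    rw [← hTl', one_mul]
    congr 1
    obtain ⟨y₂, rfl⟩ := k2
    obtain ⟨y₃, rfl⟩ := k3
    apply cls_congr
    · exact ⟨y₂, by push_cast; ring⟩
    · exact ⟨y₃, by push_cast; ring⟩
    · simp
    · simp
  have h2 := Nat.le_of_dvd (Nat.pos_of_ne_zero fun h => by
    subst h; exact NeZero.ne (3 * 0) rfl) (hz.dvd_of_pow_eq_one m h1)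
  have h3 := NeZero.pos (3 * m)
  omega

theorem isPrimitiveRoot_stdAddChar (r : ℕ) [NeZero r] (s : (ZMod r)ˣ) :
    IsPrimitiveRoot (ZMod.stdAddChar (s : ZMod r) : ℂ) r := by
  refine ⟨?_, fun n hn => ?_⟩
  · rw [← AddChar.map_nsmul_eq_pow]; simp
  · rw [← AddChar.map_nsmul_eq_pow] at hn
    have h1 := ZMod.injective_stdAddChar (hn.trans (AddChar.map_zero_eq_one _).symm)
    rw [nsmul_eq_mul, Units.mul_left_eq_zero] at h1
    exact (ZMod.natCast_eq_zero_iff _ _).mp h1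

theorem twist_left_T (r : ℕ) [NeZero r] (s : ZMod r) (h : Disc r) :
    twist r s (soAct r (T2, 1) h) = ZMod.stdAddChar s * twist r s h := by
  rw [twist_soAct r s (T2, 1) 1]
  · simp
  · simp

theorem twist_right_T (r : ℕ) [NeZero r] (s : ZMod r) (h : Disc r) :
    twist r s (soAct r (1, T2⁻¹) h) = ZMod.stdAddChar s * twist r s h := by
  rw [twist_soAct r s (1, T2⁻¹) 1]
  · simp
  · simp

/-- Because `TB ∈ Γ_{χ,r}`, the elements `T` and `B⁻¹` have the same class. So `B⁻¹`, from either
side, has the same eigenvalue on a twist as `T`. -/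
theorem T2_inv_mul_B2_inv_mem (r : ℕ) : ((T2 ^ (1 : ℤ))⁻¹ * B2⁻¹ : G2).1 ∈ GammaChi r := by
  rw [mem_GammaChi_iff_of_abelianization r (y := (T2 * B2)⁻¹)]
  · exact inv_mem (T_mul_matB_mem_GammaChi r)
  · simp [mul_comm]

theorem twist_left_B (r : ℕ) [NeZero r] (s : ZMod r) (h : Disc r) :
    twist r s (soAct r (B2⁻¹, 1) h) = ZMod.stdAddChar s * twist r s h := by
  rw [twist_soAct r s (B2⁻¹, 1) 1]
  · simp
  · simpa using T2_inv_mul_B2_inv_mem r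

theorem twist_right_B (r : ℕ) [NeZero r] (s : ZMod r) (h : Disc r) :
    twist r s (soAct r (1, B2) h) = ZMod.stdAddChar s * twist r s h := by
  rw [twist_soAct r s (1, B2) 1]
  · simp
  · simpa using T2_inv_mul_B2_inv_mem r

theorem bNum_cls (r : ℕ) (x₀ x₁ x₂ x₃ y₀ y₁ y₂ y₃ : ℤ) :
    bNum r (cls r x₀ x₁ x₂ x₃) (cls r y₀ y₁ y₂ y₃)
      = ((2 * (x₀ * y₃ + y₀ * x₃) - x₁ * y₂ - y₁ * x₂ : ℤ) : ZMod (2 * r)) := by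
  rw [bNum_eq]
  simp only [cls]
  rw [← Int.cast_mul, ← Int.cast_mul, ← Int.cast_add, dbl_intCast]
  push_cast; ring

theorem T2_zpow_coe (m : ℤ) : ((T2 ^ m : G2) : SL(2, ℤ)) = ModularGroup.T ^ m := rfl

theorem stdAddChar_half (m : ℕ) [NeZero (2 * m)] (s : (ZMod (2 * m))ˣ) :
    (ZMod.stdAddChar ((s : ZMod (2 * m)) * ((m : ℤ) : ZMod (2 * m))) : ℂ) = -1 := by
  have hm : 0 < m := by have := NeZero.pos (2 * m); omega
  have hz := isPrimitiveRoot_stdAddChar (2 * m) s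
  have h1 : (ZMod.stdAddChar ((s : ZMod (2 * m)) * ((m : ℤ) : ZMod (2 * m))) : ℂ)
      = (ZMod.stdAddChar (s : ZMod (2 * m)) : ℂ) ^ m := by
    rw [← AddChar.map_nsmul_eq_pow, nsmul_eq_mul]
    congr 1
    push_cast; ring
  rw [h1]
  exact (hz.pow (by omega) (mul_comm 2 m)).eq_neg_one_of_two_right

/-- Right multiplication by `T^{r/2}` changes the sign of the twist. For even `x₂` it does not
change the pairing with `κ_r(g)`, as the lower left entry of `g` is even too. The sum defining
`ω_r(S)` thus equals its own negative. -/
theorem weilS_twist_eq_zero (r : ℕ) [NeZero r] (hr : 2 ∣ r) (s : (ZMod r)ˣ) (x₀ x₁ x₂ x₃ : ℤ)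
    (h2 : 2 ∣ x₂) : weilS r (twist r s) (cls r x₀ x₁ x₂ x₃) = 0 := by
  obtain ⟨m, rfl⟩ := hr
  simp only [weilS, LinearMap.coe_mk, AddHom.coe_mk]
  refine mul_eq_zero_of_right _ ?_
  rw [← self_eq_neg]
  conv_lhs => rw [← Equiv.sum_comp (soAct (2 * m) (1, (T2 ^ (m : ℤ))⁻¹))]
  rw [← Finset.sum_neg_distrib]
  refine Finset.sum_congr rfl fun k _ => ?_
  rw [twist_soAct (2 * m) s _ m (by simp), stdAddChar_half]
  by_cases hk : twist (2 * m) s k = 0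
  · simp [hk]
  obtain ⟨g, hg, rfl⟩ := exists_kappa_of_twist_ne_zero _ _ hk
  have hb : bNum (2 * m) (cls (2 * m) x₀ x₁ x₂ x₃)
        (soAct (2 * m) (1, (T2 ^ (m : ℤ))⁻¹) (kappa (2 * m) g))
      = bNum (2 * m) (cls (2 * m) x₀ x₁ x₂ x₃) (kappa (2 * m) g) := by
    obtain ⟨c, hc⟩ := exists_half hg
    obtain ⟨y, rfl⟩ := h2
    rw [soAct_kappa, Subgroup.coe_inv, inv_inv, T2_zpow_coe, Subgroup.coe_one, one_mul, kappa,
      kappa, bNum_cls, bNum_cls, ZMod.intCast_eq_intCast_iff_dvd_sub]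
    simp only [mul_entry, ModularGroup.coe_T_zpow, hc]
    simp
    exact ⟨-(x₀ * c) + y * g 0 0, by ring⟩
  rw [hb]
  ring

/-- `ω_r(S)` commutes with the action, so the transform of a twist keeps its eigenvalue `ζ_r^s`, and
the support criterion applies with `z = ζ_r^s`. -/
theorem weilS_twist_support (r : ℕ) [NeZero r] (hr : r ∣ 24) (s : (ZMod r)ˣ) (x₀ x₁ x₂ x₃ : ℤ)
    (hf : weilS r (twist r s) (cls r x₀ x₁ x₂ x₃) ≠ 0) :
    (r : ℤ) ∣ 2 * (x₀ * x₃) - x₁ * x₂ + 1 := by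
  refine dvd_of_eigenfunction_ne_zero hr _ _ (isPrimitiveRoot_stdAddChar r s) ?_ ?_ ?_ ?_
    (fun h2 x₀ x₁ x₂ x₃ hx => weilS_twist_eq_zero r h2 s x₀ x₁ x₂ x₃ hx) x₀ x₁ x₂ x₃ hf
  · intro x₀ x₁ x₂ x₃
    rw [← soAct_left_T, weilS_soAct r _ _ _ (twist_left_T r s)]
  · intro x₀ x₁ x₂ x₃
    rw [← soAct_right_T, weilS_soAct r _ _ _ (twist_right_T r s)]
  · intro x₀ x₁ x₂ x₃
    rw [← soAct_left_B, weilS_soAct r _ _ _ (twist_left_B r s)]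
  · intro x₀ x₁ x₂ x₃
    rw [← soAct_right_B, weilS_soAct r _ _ _ (twist_right_B r s)]

/-! ### The action of `S` and `T` on `u_r`, `v_r`, `w_r`, and equivariance -/

theorem stdAddChar_eq_zeta_pow (r : ℕ) [NeZero r] (n : ℤ) :
    ee r (n : ZMod (2 * r)) = zeta (2 * r) ^ n := by
  rw [ee, ZMod.stdAddChar_coe, zeta, ← Complex.exp_int_mul]
  congr 1
  push_cast
  ring

theorem zeta_pow (n : ℕ) [NeZero n] : zeta n ^ n = 1 := by
  have : (n : ℂ) ≠ 0 := Nat.cast_ne_zero.mpr (NeZero.ne n)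
  rw [zeta, ← Complex.exp_nat_mul, mul_div_cancel₀ _ this, Complex.exp_two_pi_mul_I]

theorem zeta_ne_zero (n : ℕ) : zeta n ≠ 0 := Complex.exp_ne_zero _

theorem det_entries (g : SL(2, ℤ)) : g 0 0 * g 1 1 - g 0 1 * g 1 0 = 1 := by
  have := Matrix.det_fin_two g.1
  rw [Matrix.SpecialLinearGroup.det_coe] at this
  exact this.symm

/-- The support consists of classes `κ_r(g)` with `det g = 1`, where `Q_r = 1/r`. -/
theorem weilT_vecU (r : ℕ) [NeZero r] : weilT r (vecU r) = (zeta r)⁻¹ • vecU r := by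
  rw [vecU_eq_sum_twist, map_sum, Finset.smul_sum]
  refine Finset.sum_congr rfl fun s _ => funext fun h => ?_
  simp only [weilT, LinearMap.coe_mk, AddHom.coe_mk, Pi.smul_apply, smul_eq_mul]
  by_cases hk : twist r s h = 0
  · simp [hk]
  obtain ⟨g, hg, rfl⟩ := exists_kappa_of_twist_ne_zero _ _ hk
  have h2 : (2 * (g 0 0 * g 1 1) - 2 * g 0 1 * g 1 0 : ℤ) = 2 := by linear_combination 2 * det_entries g
  rw [kappa, qNum_cls, h2, ← Int.cast_neg, stdAddChar_eq_zeta_pow, zpow_neg, ← zeta_sq r]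
  norm_cast
  rw [pow_two]

/-- On the support `Q_r` is known to be `-1/2r` only modulo `1/2`. So `T` multiplies values by
`±ζ_{2r}`, and the sign disappears for `T²`. -/
theorem weilT_weilT_vecV (r : ℕ) [NeZero r] (hr : r ∣ 24) :
    weilT r (weilT r (vecV r)) = zeta r • vecV r := by
  rw [vecV, weilRep_S, vecU_eq_sum_twist]
  simp only [map_sum, Finset.smul_sum]
  refine Finset.sum_congr rfl fun s _ => funext fun h => ?_
  by_cases hk : weilS r (twist r s) h = 0
  · simp [weilT, hk]
  obtain ⟨x₀, x₁, x₂, x₃, rfl⟩ := cls_surjective r h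
  obtain ⟨a, ha⟩ := weilS_twist_support r hr s _ _ _ _ hk
  have hz := zeta_pow (2 * r)
  rw [Pi.smul_apply, smul_eq_mul, ← zeta_sq]
  simp only [weilT, LinearMap.coe_mk, AddHom.coe_mk]
  rw [← mul_assoc, qNum_cls, ← Int.cast_neg, stdAddChar_eq_zeta_pow, ← zpow_add₀ (zeta_ne_zero _),
    show -(2 * (x₀ * x₃) - x₁ * x₂) + -(2 * (x₀ * x₃) - x₁ * x₂) = 2 + (2 * r : ℕ) * (-a) by
      push_cast; linear_combination -2 * ha, zpow_add₀ (zeta_ne_zero _), zpow_mul, zpow_natCast, hz,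
    one_zpow, mul_one]
  norm_cast
  rw [pow_two]

/-- `ω_r(S)²` is the map induced by `h ↦ -h`. This is also left multiplication by `S² = -1`, an
element of `Γ_{χ,r}`, under which `u_r` is invariant. -/
theorem weilS_vecV (r : ℕ) [NeZero r] : weilS r (vecV r) = vecU r := by
  funext h
  rw [vecV, weilRep_S, weilS_sq]
  have hS : ModularGroup.S ^ 2 ∈ GammaChi r :=
    le_sup_right (a := ⁅G2, G2⁆) (Subgroup.subset_closure (by simp))
  have h1 := (mem_invariants_iff r _).mp (vecU_mem_invariants r)
    (⟨ModularGroup.S ^ 2, S_sq_mem_G2⟩, 1) (Subgroup.mem_sup_right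
      ⟨Subgroup.mem_subgroupOf.mpr hS, one_mem _⟩) h
  rw [← h1]
  congr 1
  obtain ⟨x₀, x₁, x₂, x₃, rfl⟩ := cls_surjective r h
  have hc : (ModularGroup.S ^ 2 : SL(2, ℤ)) 1 0 = 2 * (0 : ℤ) := by
    simp [pow_two, ModularGroup.coe_S]
  rw [soAct_apply, inv_one, Subgroup.coe_one, actR_one, actL_cls r hc]
  simp [cls, pow_two, ModularGroup.coe_S]

theorem weilT_vecV (r : ℕ) [NeZero r] : weilT r (vecV r) = zeta (2 * r) • vecW r := by
  rw [vecW, weilRep_T, smul_smul, mul_inv_cancel₀ (zeta_ne_zero _), one_smul]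

theorem weilS_vecU (r : ℕ) [NeZero r] : weilS r (vecU r) = vecV r := by rw [vecV, weilRep_S]

theorem weilT_vecW (r : ℕ) [NeZero r] (hr : r ∣ 24) :
    weilT r (vecW r) = zeta (2 * r) • vecV r := by
  rw [vecW, weilRep_T, map_smul, weilT_weilT_vecV r hr, smul_smul, ← zeta_sq r,
    inv_mul_cancel_left₀ (zeta_ne_zero _)]

theorem weilT_injective (r : ℕ) [NeZero r] : Function.Injective (weilT r) := by
  intro f g h
  funext μ
  exact mul_left_cancel₀ ((ee r).val_isUnit _).ne_zero (congrFun h μ)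

/-- Applying `TSTST = S` to `u_r` and inserting the known actions gives `T S w_r = ζ_{2r} v_r = T
w_r`; then `T` is cancelled. -/
theorem weilS_vecW (r : ℕ) [NeZero r] (hr : r ∣ 24) : weilS r (vecW r) = vecW r := by
  have h : weilT r (weilS r (weilT r (weilS r (weilT r (vecU r))))) = weilS r (vecU r) :=
    funext fun μ => weilSTS r _ μ
  simp only [weilT_vecU, map_smul, weilS_vecU, weilT_vecV] at h
  apply weilT_injective r
  rw [weilT_vecW r hr, ← h, smul_smul, smul_smul, ← zeta_sq r]
  have := zeta_ne_zero (2 * r)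
  convert (one_smul ℂ _).symm using 2
  field_simp

theorem iota_apply (r : ℕ) [NeZero r] (x : Fin 3 → ℂ) :
    iota r x = x 0 • vecU r + x 1 • vecV r + x 2 • vecW r := rfl

theorem iota_varrhoS (r : ℕ) [NeZero r] (hr : r ∣ 24) (x : Fin 3 → ℂ) :
    iota r (varrho r ModularGroup.S x) = weilRep r ModularGroup.S (iota r x) := by
  rw [weilRep_S, varrho_S, iota_apply, iota_apply]
  simp only [map_add, map_smul, weilS_vecU, weilS_vecV, weilS_vecW r hr]
  simp [varrhoS, Matrix.mulVec, dotProduct, Fin.sum_univ_three]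
  abel

theorem iota_varrhoT (r : ℕ) [NeZero r] (hr : r ∣ 24) (x : Fin 3 → ℂ) :
    iota r (varrho r ModularGroup.T x) = weilRep r ModularGroup.T (iota r x) := by
  rw [weilRep_T, varrho_T, iota_apply, iota_apply]
  simp only [map_add, map_smul, weilT_vecU, weilT_vecV, weilT_vecW r hr]
  simp [varrhoT, Matrix.mulVec, dotProduct, Fin.sum_univ_three]
  module

/-- Induction on `SL(2, ℤ)` by multiplication with the generators `S`, `T` and `T⁻¹`. -/
theorem SL2Z_induction {p : SL(2, ℤ) → Prop} (h1 : p 1) (hS : ∀ g, p g → p (ModularGroup.S * g))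
    (hT : ∀ g, p g → p (ModularGroup.T * g)) (hT' : ∀ g, p g → p (ModularGroup.T⁻¹ * g))
    (g : SL(2, ℤ)) : p g := by
  have hg : g ∈ Subgroup.closure {ModularGroup.S, ModularGroup.T} := by
    rw [SpecialLinearGroup.SL2Z_generators]; trivial
  have hS' : (ModularGroup.S⁻¹ : SL(2, ℤ)) = ModularGroup.S * (ModularGroup.S * ModularGroup.S) := by
    rw [inv_eq_iff_mul_eq_one]
    ext i j; fin_cases i <;> fin_cases j <;>
      simp [Matrix.mul_apply, Fin.sum_univ_two, ModularGroup.coe_S]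
  induction hg using Subgroup.closure_induction_left with
  | one => exact h1
  | mul_left a ha y hy ih =>
    rcases ha with rfl | rfl
    · exact hS _ ih
    · exact hT _ ih
  | inv_mul_cancel a ha y hy ih =>
    rcases ha with rfl | rfl
    · rw [hS', mul_assoc, mul_assoc]; exact hS _ (hS _ (hS _ ih))
    · exact hT' _ ih

theorem iota_varrho (r : ℕ) [NeZero r] (hr : r ∣ 24) (γ : SL(2, ℤ)) (x : Fin 3 → ℂ) :
    iota r (varrho r γ x) = weilRep r γ (iota r x) := by
  induction γ using SL2Z_induction generalizing x with
  | h1 => simp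
  | hS g ih => rw [map_mul, map_mul, Module.End.mul_apply, Module.End.mul_apply,
      iota_varrhoS r hr, ih]
  | hT g ih => rw [map_mul, map_mul, Module.End.mul_apply, Module.End.mul_apply,
      iota_varrhoT r hr, ih]
  | hT' g ih =>
    -- Equivariance for `T⁻¹` is equivariance for `T` at the vector moved back by `T⁻¹`.
    have h := iota_varrhoT r hr (varrho r ModularGroup.T⁻¹ (varrho r g x))
    rw [← Module.End.mul_apply (varrho r ModularGroup.T), ← map_mul, mul_inv_cancel, map_one,
      Module.End.one_apply] at h
    rw [map_mul, map_mul, Module.End.mul_apply, Module.End.mul_apply, ← ih, h,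
      ← Module.End.mul_apply (weilRep r _), ← map_mul, inv_mul_cancel, map_one,
      Module.End.one_apply]

end Support
/-! ### A character of `Γ₀(2)` trivial on `Γ_{χ,r}` -/

section Character

/-- The 2-part of the exponent of the character of `η(2τ)/η(τ)` on `(a, b; 2c, d)`. -/
def expo8 (a b c : ℤ) : ℤ := a * (b + c) + (a ^ 2 - 1) / 2

/-- The 3-part of the exponent of the character of `η(2τ)/η(τ)` on `(a, b; c, d)`. -/
def expo3 (a b c d : ℤ) : ℤ := c * (a + d) - b * d * (c ^ 2 - 1)

theorem odd_of_det {a b c d : ℤ} (h : a * d = 1 + 2 * (b * c)) : Odd a := by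
  have h1 : Odd (a * d) := ⟨b * c, by linarith⟩
  exact (Int.odd_mul.mp h1).1

/-- Since `a` and `a'` are odd, their squares are `1` modulo `8`. Using this and the determinants,
the difference reduces to twice the expression in `key`. That one is needed only modulo `4`, where
`d = a (1 + 2bc)` can be eliminated and finitely many cases remain. -/
theorem expo8_mul {a b c d a' b' c' d' : ℤ} (h : a * d = 1 + 2 * (b * c))
    (h' : a' * d' = 1 + 2 * (b' * c')) :
    (8 : ℤ) ∣ expo8 (a * a' + 2 * (b * c')) (a * b' + b * d') (c * a' + d * c')
      - (expo8 a b c + expo8 a' b' c') := by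
  have sq : ∀ x : ℤ, Odd x → (8 : ℤ) ∣ x ^ 2 - 1 := fun x hx => Int.eight_dvd_sq_sub_one_of_odd hx
  have ha := odd_of_det h
  have ha' := odd_of_det h'
  have ha'' : Odd (a * a' + 2 * (b * c')) := (ha.mul ha').add_even (even_two_mul _)
  have key : (4 : ℤ) ∣ b * c' * (2 * (a * b') + 2 * (a' * c) + a * a' + b * c' + b * d' + d * c') := by
    have hdec : ∀ a a' b c b' c' : ZMod 4, a * a = 1 → a' * a' = 1 →
        b * c' * (2 * (a * b') + 2 * (a' * c) + a * a' + b * c' + b * (a' * (1 + 2 * (b' * c')))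
          + (a * (1 + 2 * (b * c))) * c') = 0 := by decide
    have s4 : ∀ x : ℤ, Odd x → (x : ZMod 4) * x = 1 := fun x hx => by
      have h1 : ((x ^ 2 - 1 : ℤ) : ZMod 4) = 0 := by
        rw [ZMod.intCast_zmod_eq_zero_iff_dvd]
        exact (by norm_num : (4 : ℤ) ∣ 8).trans (sq x hx)
      push_cast at h1
      linear_combination h1
    have hd : (d : ZMod 4) = a * (1 + 2 * (b * c)) := by
      have := congrArg (Int.cast : ℤ → ZMod 4) h
      push_cast at this
      linear_combination (a : ZMod 4) * this - (d : ZMod 4) * s4 a ha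
    have hd' : (d' : ZMod 4) = a' * (1 + 2 * (b' * c')) := by
      have := congrArg (Int.cast : ℤ → ZMod 4) h'
      push_cast at this
      linear_combination (a' : ZMod 4) * this - (d' : ZMod 4) * s4 a' ha'
    refine (ZMod.intCast_zmod_eq_zero_iff_dvd _ 4).mp ?_
    push_cast
    rw [hd, hd']
    exact hdec _ _ _ _ _ _ (s4 a ha) (s4 a' ha')
  obtain ⟨k, hk⟩ := sq a ha
  obtain ⟨k', hk'⟩ := sq a' ha'
  obtain ⟨k'', hk''⟩ := sq _ ha''
  obtain ⟨l, hl⟩ := key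
  have e : ∀ x y : ℤ, x = 8 * y → x / 2 = 4 * y := fun x y h => by omega
  simp only [expo8]
  rw [e _ _ hk, e _ _ hk', e _ _ hk'']
  have h2 : 8 * k'' = 8 * (8 * (k * k') + k + k') + 4 * (a * a' * (b * c')) + 4 * (b * c') ^ 2 := by
    rw [← hk'']
    linear_combination (a' ^ 2) * hk + (1 + 8 * k) * hk'
  have h3 : 4 * k'' = 4 * (8 * (k * k') + k + k') + 2 * (a * a' * (b * c')) + 2 * (b * c') ^ 2 := by
    linarith
  refine ⟨k * (a' * b') + k' * (a * c) + 4 * (k * k') + l, ?_⟩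
  linear_combination h3 + a' * b' * hk + a * c * hk' + 2 * hl + a * b * h' + a' * c' * h

theorem expo3_mul {a b c d a' b' c' d' : ℤ} (h : a * d - b * c = 1) (h' : a' * d' - b' * c' = 1) :
    (3 : ℤ) ∣ expo3 (a * a' + b * c') (a * b' + b * d') (c * a' + d * c') (c * b' + d * d')
      - (expo3 a b c d + expo3 a' b' c' d') := by
  have hdec : ∀ a b c d : ZMod 3, a * d - b * c = 1 → ∀ a' b' c' d' : ZMod 3,
      a' * d' - b' * c' = 1 →
      (c * a' + d * c') * ((a * a' + b * c') + (c * b' + d * d'))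
      - (a * b' + b * d') * (c * b' + d * d') * ((c * a' + d * c') ^ 2 - 1)
      - ((c * (a + d) - b * d * (c ^ 2 - 1)) + (c' * (a' + d') - b' * d' * (c' ^ 2 - 1))) = 0 := by
    decide
  refine (ZMod.intCast_zmod_eq_zero_iff_dvd _ 3).mp ?_
  have h1 := congrArg (Int.cast : ℤ → ZMod 3) h
  have h1' := congrArg (Int.cast : ℤ → ZMod 3) h'
  push_cast at h1 h1'
  simp only [expo3]
  push_cast
  exact hdec _ _ _ _ h1 _ _ _ _ h1'

/-- The exponent of the character of `η(2τ)/η(τ)`, an integer modulo `24`. -/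
def expo24 (g : SL(2, ℤ)) : ℤ :=
  9 * expo8 (g 0 0) (g 0 1) (g 1 0 / 2) + 16 * expo3 (g 0 0) (g 0 1) (g 1 0) (g 1 1)

/-- The weights `9` and `16` are the idempotents of `ℤ/24 = ℤ/8 × ℤ/3`, so additivity of `expo8`
modulo `8` and of `expo3` modulo `3` suffices. -/
theorem expo24_mul {g g' : SL(2, ℤ)} (hg : g ∈ G2) (hg' : g' ∈ G2) :
    (24 : ℤ) ∣ expo24 (g * g') - (expo24 g + expo24 g') := by
  obtain ⟨c, hc⟩ := exists_half hg
  obtain ⟨c', hc'⟩ := exists_half hg'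
  have d1 := det_entries g
  have d2 := det_entries g'
  obtain ⟨k, hk⟩ := expo3_mul d1 d2
  rw [hc] at d1
  rw [hc'] at d2
  obtain ⟨l, hl⟩ := expo8_mul (a := g 0 0) (b := g 0 1) (c := c) (d := g 1 1)
    (a' := g' 0 0) (b' := g' 0 1) (c' := c') (d' := g' 1 1)
    (by linear_combination d1) (by linear_combination d2)
  have hm : (g * g') 1 0 / 2 = c * g' 0 0 + g 1 1 * c' := by
    rw [mul_entry, hc, hc',
      show 2 * c * g' 0 0 + g 1 1 * (2 * c') = 2 * (c * g' 0 0 + g 1 1 * c') by ring]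
    omega
  have hh : g 1 0 / 2 = c := by omega
  have hh' : g' 1 0 / 2 = c' := by omega
  simp only [expo24, hm, hh, hh']
  simp only [mul_entry]
  refine ⟨3 * l + 2 * k, ?_⟩
  have e8 : g 0 0 * g' 0 0 + g 0 1 * g' 1 0 = g 0 0 * g' 0 0 + 2 * (g 0 1 * c') := by
    rw [hc']; ring
  rw [← e8] at hl
  linear_combination 9 * hl + 16 * hk

/-- The character `Γ₀(2) → ℤ/r` with `T ↦ 1` and `B ↦ -1`. -/
def charG2 (r : ℕ) (hr : r ∣ 24) : G2 →* Multiplicative (ZMod r) :=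
  MonoidHom.mk' (fun g => Multiplicative.ofAdd (expo24 g : ZMod r)) fun g g' => by
    rw [← ofAdd_add, ← Int.cast_add]
    congr 1
    rw [eq_comm, ZMod.intCast_eq_intCast_iff_dvd_sub]
    exact (by exact_mod_cast hr : (r : ℤ) ∣ 24).trans (expo24_mul g.2 g'.2)

theorem charG2_T (r : ℕ) (hr : r ∣ 24) : charG2 r hr T2 = Multiplicative.ofAdd 1 := by
  change Multiplicative.ofAdd ((expo24 ModularGroup.T : ℤ) : ZMod r) = _
  congr 1
  -- Both partial exponents of `T` are `1`, and `9 + 16 = 25`.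
  have h : expo24 ModularGroup.T = 1 + 24 := by
    simp [expo24, expo8, expo3, ModularGroup.coe_T]
  have h24 : (((24 : ℕ) : ℤ) : ZMod r) = 0 := by
    rw [Int.cast_natCast]; exact (ZMod.natCast_eq_zero_iff 24 r).mpr hr
  rw [h, Int.cast_add, Int.cast_one]
  simpa using h24

/-- The target is abelian, so commutators are killed; the other generators are checked one by one.
-/
theorem charG2_eq_one_of_mem (r : ℕ) (hr : r ∣ 24) {g : G2} (hg : g.1 ∈ GammaChi r) :
    charG2 r hr g = 1 := by
  suffices h : GammaChi r ≤ (charG2 r hr).ker.map G2.subtype by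
    obtain ⟨g', hg', he⟩ := h hg
    rwa [← Subtype.ext he]
  refine sup_le ?_ ?_
  · rw [← Subgroup.map_subtype_commutator]
    exact Subgroup.map_mono (Abelianization.commutator_subset_ker _)
  · rw [Subgroup.closure_le]
    have hpow : ∀ n : ℕ, r ∣ n → ModularGroup.T ^ n ∈ (charG2 r hr).ker.map G2.subtype := by
      intro n hn
      refine ⟨T2 ^ n, ?_, rfl⟩
      rw [SetLike.mem_coe, MonoidHom.mem_ker, map_pow, charG2_T, ← ofAdd_nsmul]
      simpa using (ZMod.natCast_eq_zero_iff n r).mpr hn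
    rintro g (rfl | rfl | rfl | rfl)
    · exact hpow 24 hr
    · refine ⟨⟨_, S_sq_mem_G2⟩, ?_, rfl⟩
      change Multiplicative.ofAdd ((expo24 (ModularGroup.S ^ 2) : ℤ) : ZMod r) = 1
      simp [expo24, expo8, expo3, ModularGroup.coe_S, pow_two]
    · refine ⟨T2 * B2, ?_, rfl⟩
      change Multiplicative.ofAdd ((expo24 (ModularGroup.T * matB) : ℤ) : ZMod r) = 1
      rw [show expo24 (ModularGroup.T * matB) = ((24 : ℕ) : ℤ) * (-2) by
          simp [expo24, expo8, expo3, ModularGroup.coe_T, matB_apply],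
        Int.cast_mul, Int.cast_natCast, (ZMod.natCast_eq_zero_iff 24 r).mpr hr, zero_mul]
      rfl
    · exact hpow r dvd_rfl

/-- For `g = (a, b; 2c, d)` the hypothesis gives `a ≡ 1` and `b ≡ c ≡ 0` modulo `r`, which makes
each term of the exponent divisible by `r`. For `(a² - 1)/2` this uses that `a` is odd, so that `(a
+ 1)/2` is an integer. -/
theorem dvd_expo24_of_kappa_eq {r : ℕ} {g : SL(2, ℤ)} (hg : g ∈ G2)
    (h : kappa r g = kappa r 1) : (r : ℤ) ∣ expo24 g := by
  obtain ⟨c, hc⟩ := exists_half hg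
  have e : ∀ (m : ℕ) (x y : ℤ), (x : ZMod m) = y → (m : ℤ) ∣ x - y := fun m x y h => by
    rw [eq_comm, ZMod.intCast_eq_intCast_iff_dvd_sub] at h; exact h
  simp only [kappa, cls, Prod.mk.injEq] at h
  obtain ⟨h0, h1, h2, -⟩ := h
  have h0 := e _ _ _ h0
  have h1 := e _ _ _ h1
  have h2 := e _ _ _ h2
  simp [hc] at h0 h1 h2
  have h1 := Int.dvd_of_mul_dvd_mul_left (by norm_num) h1
  have h2 := Int.dvd_of_mul_dvd_mul_left (by norm_num) h2
  have ha : Odd (g 0 0) := by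
    refine odd_of_det (b := g 0 1) (c := c) (d := g 1 1) ?_
    have := det_entries g
    rw [hc] at this
    linear_combination this
  have hsq : (r : ℤ) ∣ 9 * ((g 0 0 ^ 2 - 1) / 2) := by
    obtain ⟨k, hk⟩ := h0
    obtain ⟨l, hl⟩ := ha
    have e2 : (g 0 0 ^ 2 - 1) / 2 = (g 0 0 - 1) * (l + 1) := by
      rw [show g 0 0 ^ 2 - 1 = 2 * ((g 0 0 - 1) * (l + 1)) by rw [hl]; ring]
      omega
    rw [e2, hk]
    exact ⟨9 * k * (l + 1), by ring⟩
  have hh : g 1 0 / 2 = c := by omega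
  rw [expo24, hh, expo8, expo3, hc]
  obtain ⟨x, hx⟩ := h1
  obtain ⟨y, hy⟩ := h2
  obtain ⟨w, hw⟩ := hsq
  rw [mul_add, hw, hx, hy]
  exact ⟨9 * g 0 0 * (x + y) + w + 16 * (2 * y * (g 0 0 + g 1 1))
    - 16 * x * g 1 1 * ((2 * (r * y)) ^ 2 - 1), by ring⟩

/-- If `κ_r(T^j γ) = κ_r(1)`, the character is trivial on `T^j γ` by the congruences, yet its value
there is `j`. So no cancellation between cosets occurs at `κ_r(1)`. -/
theorem kappa_one_mem_kappaCoset_iff (r : ℕ) [NeZero r] (hr : r ∣ 24) (j : ZMod r) :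
    kappa r 1 ∈ kappaCoset r j ↔ j = 0 := by
  constructor
  · rintro ⟨γ, hγ, h⟩
    have hG : ModularGroup.T ^ j.val * γ ∈ G2 := mul_mem (pow_mem T_mem_G2 _) (GammaChi_le r hγ)
    have h1 := dvd_expo24_of_kappa_eq hG h.symm
    have h2 : charG2 r hr (T2 ^ j.val * ⟨γ, GammaChi_le r hγ⟩) = 1 := by
      change Multiplicative.ofAdd ((expo24 (ModularGroup.T ^ j.val * γ) : ℤ) : ZMod r) = 1
      rw [(ZMod.intCast_zmod_eq_zero_iff_dvd _ r).mpr h1]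
      rfl
    rw [map_mul, map_pow, charG2_T, charG2_eq_one_of_mem r hr hγ, mul_one, ← ofAdd_nsmul] at h2
    have h3 : j.val • (1 : ZMod r) = 0 := h2
    simpa using h3
  · rintro rfl
    rw [mem_kappaCoset_iff r 0 _ 0 (by simp)]
    exact ⟨1, one_mem _, by simp⟩

end Character

/-! ### Injectivity -/

section Injective

theorem twist_kappa_one (r : ℕ) [NeZero r] (hr : r ∣ 24) (s : ZMod r) :
    twist r s (kappa r 1) = 1 := by
  classical
  simp only [twist_apply, Set.indicator_apply, kappa_one_mem_kappaCoset_iff r hr]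
  simp

theorem kappa_one (r : ℕ) : kappa r 1 = cls r 1 0 0 1 := by simp [kappa]

theorem exists_kappa_of_vecU_ne_zero (r : ℕ) [NeZero r] {h : Disc r}
    (hh : vecU r h ≠ 0) : ∃ g ∈ G2, h = kappa r g := by
  rw [vecU_eq_sum_twist, Finset.sum_apply] at hh
  obtain ⟨s, -, hs⟩ := Finset.exists_ne_zero_of_sum_ne_zero hh
  exact exists_kappa_of_twist_ne_zero r s hs

/-- `u_r` is supported on classes `κ_r(g)` with even lower left entry `2c`, and the translation
changes the pairing numerator by a multiple of `2r`. -/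
theorem vecV_shift (r : ℕ) [NeZero r] (x₀ x₁ x₂ x₃ : ℤ) :
    vecV r (cls r x₀ (x₁ + r) x₂ x₃) = vecV r (cls r x₀ x₁ x₂ x₃) := by
  rw [vecV, weilRep_S]
  simp only [weilS, LinearMap.coe_mk, AddHom.coe_mk]
  congr 1
  refine Finset.sum_congr rfl fun k _ => ?_
  by_cases hk : vecU r k = 0
  · simp [hk]
  obtain ⟨g, hg, rfl⟩ := exists_kappa_of_vecU_ne_zero r hk
  obtain ⟨c, hc⟩ := exists_half hg
  congr 2
  rw [kappa, bNum_cls, bNum_cls, ZMod.intCast_eq_intCast_iff_dvd_sub, hc]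
  exact ⟨c, by push_cast; ring⟩

/-- For even `r` the translate of `κ_r(1)` is `κ_r(T^{r/2})`, where each twist is `-1`. For odd `r`
its second coordinate is odd, so it is outside the image of `κ_r` and each twist is `0`. The value
does not depend on `s`, so nothing can cancel in the sum over `s`. -/
theorem twist_shift_ne (r : ℕ) [NeZero r] (hr : r ∣ 24) :
    ∃ c : ℂ, c ≠ 1 ∧ ∀ s : (ZMod r)ˣ, twist r s (cls r 1 r 0 1) = c := by
  rcases Nat.even_or_odd r with he | ho
  · obtain ⟨m, rfl⟩ := he.two_dvd
    refine ⟨-1, by norm_num, fun s => ?_⟩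
    rw [show cls (2 * m) 1 (2 * m : ℕ) 0 1 = soAct (2 * m) (1, (T2 ^ (m : ℤ))⁻¹) (kappa (2 * m) 1) by
      rw [soAct_kappa, Subgroup.coe_inv, inv_inv, T2_zpow_coe, Subgroup.coe_one, one_mul, one_mul]
      simp only [kappa, ModularGroup.coe_T_zpow]
      simp,
      twist_soAct (2 * m) s _ m (by simp), twist_kappa_one _ hr, stdAddChar_half, mul_one]
  · refine ⟨0, by norm_num, fun s => ?_⟩
    by_contra h
    obtain ⟨g, hg, he⟩ := exists_kappa_of_twist_ne_zero r s h
    have h1 := congrArg (fun x : Disc r => ZMod.castHom (dvd_mul_right 2 r) (ZMod 2) x.2.1) he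
    simp only [kappa, cls, map_intCast] at h1
    rw [ZMod.intCast_eq_intCast_iff_dvd_sub] at h1
    have := Int.odd_iff.mp ((Int.odd_coe_nat r).mpr ho)
    push_cast at h1
    omega

theorem iota_injective (r : ℕ) [NeZero r] (hr : r ∣ 24) : Function.Injective (iota r) := by
  rw [← LinearMap.ker_eq_bot, LinearMap.ker_eq_bot']
  have h0 : ∀ x, iota r x = 0 → x 0 = 0 := by
    intro x hx
    have h1 := congrFun hx (kappa r 1)
    have h2 := congrFun hx (cls r 1 (0 + r) 0 1)
    simp only [iota_apply, Pi.add_apply, Pi.smul_apply, smul_eq_mul, Pi.zero_apply] at h1 h2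
    -- `Q_r` is also the same at both points, because `h₂ = 0`.
    have hW : vecW r (cls r 1 (0 + r) 0 1) = vecW r (kappa r 1) := by
      rw [vecW, weilRep_T, kappa_one]
      simp only [weilT, LinearMap.coe_mk, AddHom.coe_mk, Pi.smul_apply, vecV_shift, qNum_cls]
      simp
    rw [hW, vecV_shift, ← kappa_one, zero_add] at h2
    obtain ⟨c, hc, hs⟩ := twist_shift_ne r hr
    have hU1 : vecU r (kappa r 1) = Fintype.card (ZMod r)ˣ := by
      simp [vecU_eq_sum_twist, Finset.sum_apply, twist_kappa_one r hr]
    have hU2 : vecU r (cls r 1 r 0 1) = Fintype.card (ZMod r)ˣ * c := by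
      simp [vecU_eq_sum_twist, Finset.sum_apply, hs]
    rw [hU1] at h1
    rw [hU2] at h2
    have h3 : x 0 * (Fintype.card (ZMod r)ˣ * (1 - c)) = 0 := by linear_combination h1 - h2
    have h4 : (Fintype.card (ZMod r)ˣ : ℂ) ≠ 0 := Nat.cast_ne_zero.mpr Fintype.card_ne_zero
    have h5 : 1 - c ≠ 0 := sub_ne_zero.mpr hc.symm
    exact (mul_eq_zero.mp h3).resolve_right (mul_ne_zero h4 h5)
  -- The kernel is stable under `ϱ_r`: `S` moves the second coordinate to the first, and below `T`
  -- moves the third to the second up to a unit.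
  have h1 : ∀ x, iota r x = 0 → x 1 = 0 := by
    intro x hx
    have := h0 (varrho r ModularGroup.S x) (by rw [iota_varrhoS r hr, hx, map_zero])
    rw [varrho_S] at this
    simpa [varrhoS, Matrix.mulVec, dotProduct, Fin.sum_univ_three] using this
  intro x hx
  have h2 : x 2 = 0 := by
    have := h1 (varrho r ModularGroup.T x) (by rw [iota_varrhoT r hr, hx, map_zero])
    rw [varrho_T] at this
    simpa [varrhoT, Matrix.mulVec, dotProduct, Fin.sum_univ_three, zeta_ne_zero] using this
  ext i; fin_cases i
  · exact h0 x hx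
  · exact h1 x hx
  · exact h2

end Injective
/-! ### The Euler product -/

section Euler

/-- `∏_{n ≥ 1} (1 - xⁿ)`. -/
def eulerProd (x : ℂ) : ℂ := ∏' n : ℕ, (1 - x ^ (n + 1))

theorem eulerProd_zero : eulerProd 0 = 1 := by simp [eulerProd]

theorem eulerProd_ne_zero {x : ℂ} (hx : ‖x‖ < 1) : eulerProd x ≠ 0 := by
  rw [eulerProd]
  simp only [sub_eq_add_neg]
  refine tprod_one_add_ne_zero_of_summable (f := fun n : ℕ => -x ^ (n + 1)) (fun n h => ?_) ?_
  · have h1 : x ^ (n + 1) = 1 := by linear_combination -h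
    have h2 : ‖x‖ ^ (n + 1) = 1 := by rw [← norm_pow, h1, norm_one]
    exact (pow_lt_one₀ (norm_nonneg x) hx (by omega)).ne h2
  · simpa using (summable_nat_add_iff 1).mpr (summable_geometric_of_lt_one (norm_nonneg _) hx)

theorem differentiableAt_eulerProd {x : ℂ} (hx : ‖x‖ < 1) : DifferentiableAt ℂ eulerProd x :=
  ModularForm.differentiableOn_tprod_one_sub_pow.differentiableAt
    (Metric.isOpen_ball.mem_nhds (by simpa using hx))

theorem analyticAt_eulerProd_zero : AnalyticAt ℂ eulerProd 0 :=
  ModularForm.differentiableOn_tprod_one_sub_pow.analyticAt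
    (Metric.isOpen_ball.mem_nhds (by simp))

/-- `∏_{n ≥ 0} (1 - x^{2n+1})`. -/
def oddProd (x : ℂ) : ℂ := ∏' n : ℕ, (1 - x ^ (2 * n + 1))

theorem multipliable_oddProd {x : ℂ} (hx : ‖x‖ < 1) :
    Multipliable fun n : ℕ => 1 - x ^ (2 * n + 1) := by
  simp only [sub_eq_add_neg]
  apply multipliable_one_add_of_summable (f := fun n : ℕ => -x ^ (2 * n + 1))
  have h := (summable_geometric_of_lt_one (norm_nonneg _) hx).comp_injective
    (i := fun n : ℕ => 2 * n + 1) (fun a b h => by simpa using h)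
  simpa [Function.comp_def] using h

theorem eulerProd_eq_oddProd_mul {x : ℂ} (hx : ‖x‖ < 1) :
    eulerProd x = oddProd x * eulerProd (x ^ 2) := by
  have hx2 : ‖x ^ 2‖ < 1 := by
    rw [norm_pow]; exact pow_lt_one₀ (norm_nonneg x) hx two_ne_zero
  have e : ∀ n : ℕ, 1 - x ^ (2 * n + 1 + 1) = 1 - (x ^ 2) ^ (n + 1) := fun n => by
    rw [← pow_mul]; congr 2
  have h := tprod_even_mul_odd (f := fun n : ℕ => 1 - x ^ (n + 1)) (multipliable_oddProd hx)
    (by simpa only [e] using ModularForm.multipliable_one_sub_pow hx2)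
  simp only [e] at h
  exact h.symm

theorem oddProd_mul_oddProd_neg {x : ℂ} (hx : ‖x‖ < 1) :
    oddProd x * oddProd (-x) = oddProd (x ^ 2) := by
  rw [oddProd, oddProd, ← (multipliable_oddProd hx).tprod_mul
    (multipliable_oddProd (by rwa [norm_neg])), oddProd]
  refine tprod_congr fun n => ?_
  rw [Odd.neg_pow ⟨n, rfl⟩]
  ring

/-- Write `E` and `O` for the full and the odd product. Then `E(±x) = O(±x) E(x²)`, `O(x) O(-x) =
O(x²)` and `O(x²) E(x⁴) = E(x²)`. At `x = q^{1/2}` this is the identity behind `𝔣 𝔣₁ 𝔣₂ = √2`. -/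
theorem eulerProd_mul_eulerProd_neg {x : ℂ} (hx : ‖x‖ < 1) :
    eulerProd (-x) * eulerProd x * eulerProd (x ^ 4) = eulerProd (x ^ 2) ^ 3 := by
  have hx2 : ‖x ^ 2‖ < 1 := by
    rw [norm_pow]; exact pow_lt_one₀ (norm_nonneg x) hx two_ne_zero
  have h1 := eulerProd_eq_oddProd_mul hx
  have h2 := eulerProd_eq_oddProd_mul (x := -x) (by rwa [norm_neg])
  have h3 := eulerProd_eq_oddProd_mul hx2
  rw [neg_sq] at h2
  rw [← pow_mul] at h3
  norm_num at h3
  rw [h1, h2]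
  linear_combination (eulerProd (x ^ 2) ^ 2 * eulerProd (x ^ 4)) * oddProd_mul_oddProd_neg hx
    - eulerProd (x ^ 2) ^ 2 * h3

end Euler

/-! ### Weber functions in terms of `q^{1/48}` -/

section Weber

open ModularForm (eta eta_ne_zero)

theorem eta_eq (z : ℂ) : eta z = Complex.exp (2 * Real.pi * Complex.I * z / 24) *
    eulerProd (Complex.exp (2 * Real.pi * Complex.I * z)) := by
  simp [eta, eulerProd, Function.Periodic.qParam, ModularForm.eta_q]

/-- The local parameter `q^{1/48}`. -/
def qRoot (τ : ℍ) : ℂ := Complex.exp (2 * Real.pi * Complex.I * τ / 48)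

theorem qRoot_ne_zero (τ : ℍ) : qRoot τ ≠ 0 := Complex.exp_ne_zero _

theorem norm_qRoot (τ : ℍ) : ‖qRoot τ‖ = Real.exp (-(2 * Real.pi * τ.im) / 48) := by
  rw [qRoot, Complex.norm_exp]
  congr 1
  rw [show (48 : ℂ) = ((48 : ℝ) : ℂ) by norm_num, Complex.div_ofReal_re]
  simp

theorem norm_qRoot_lt_one (τ : ℍ) : ‖qRoot τ‖ < 1 := by
  rw [norm_qRoot, Real.exp_lt_one_iff]
  have := mul_pos Real.pi_pos τ.im_pos
  have h : -(2 * Real.pi * τ.im) / 48 = -(Real.pi * τ.im / 24) := by ring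
  rw [h]; simpa using by positivity

theorem norm_pow_lt_one {t : ℂ} (ht : ‖t‖ < 1) {n : ℕ} (hn : n ≠ 0) : ‖t ^ n‖ < 1 := by
  rw [norm_pow]; exact pow_lt_one₀ (norm_nonneg t) ht hn

theorem eta_coe (τ : ℍ) : eta τ = qRoot τ ^ 2 * eulerProd (qRoot τ ^ 48) := by
  rw [eta_eq, qRoot, ← Complex.exp_nat_mul, ← Complex.exp_nat_mul]
  congr 2
  · push_cast; ring
  · congr 1; push_cast; ring

theorem eta_two_mul (τ : ℍ) : eta (2 * (τ : ℂ)) = qRoot τ ^ 4 * eulerProd (qRoot τ ^ 96) := by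
  rw [eta_eq, qRoot, ← Complex.exp_nat_mul, ← Complex.exp_nat_mul]
  congr 2
  · push_cast; ring
  · congr 1; push_cast; ring

theorem eta_half (τ : ℍ) : eta ((τ : ℂ) / 2) = qRoot τ * eulerProd (qRoot τ ^ 24) := by
  rw [eta_eq, qRoot, ← Complex.exp_nat_mul]
  congr 2
  · ring
  · congr 1; push_cast; ring

theorem eta_add_one_half (τ : ℍ) :
    eta (((τ : ℂ) + 1) / 2) = zeta 48 * qRoot τ * eulerProd (-qRoot τ ^ 24) := by
  have h : -qRoot τ ^ 24 = Complex.exp (2 * Real.pi * Complex.I * (((τ : ℂ) + 1) / 2)) := by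
    rw [qRoot, ← Complex.exp_nat_mul, ← mul_neg_one, ← Complex.exp_pi_mul_I, ← Complex.exp_add]
    congr 1; push_cast; ring
  rw [eta_eq, h, qRoot, zeta, ← Complex.exp_add]
  congr 2
  push_cast; ring

theorem eta_add_one (z : ℂ) : eta (z + 1) = zeta 24 * eta z := by
  rw [eta_eq, eta_eq, zeta, ← mul_assoc, ← Complex.exp_add]
  congr 2
  · push_cast; ring
  · rw [mul_add, mul_one, Complex.exp_add, Complex.exp_two_pi_mul_I, mul_one]

theorem weberF_eq (τ : ℍ) : weberF τ =
    eulerProd (-qRoot τ ^ 24) / (qRoot τ * eulerProd (qRoot τ ^ 48)) := by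
  rw [weberF, eta_add_one_half, eta_coe]
  have h1 := zeta_ne_zero 48
  have h2 := qRoot_ne_zero τ
  have h3 := eulerProd_ne_zero (norm_pow_lt_one (norm_qRoot_lt_one τ) (n := 48) (by norm_num))
  field_simp

theorem weberF1_eq (τ : ℍ) : weberF1 τ =
    eulerProd (qRoot τ ^ 24) / (qRoot τ * eulerProd (qRoot τ ^ 48)) := by
  rw [weberF1, eta_half, eta_coe]
  have h2 := qRoot_ne_zero τ
  have h3 := eulerProd_ne_zero (norm_pow_lt_one (norm_qRoot_lt_one τ) (n := 48) (by norm_num))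
  field_simp

theorem weberF2_eq (τ : ℍ) : weberF2 τ = (Real.sqrt 2 : ℂ) *
    (qRoot τ ^ 2 * eulerProd (qRoot τ ^ 96) / eulerProd (qRoot τ ^ 48)) := by
  rw [weberF2, eta_two_mul, eta_coe]
  have h2 := qRoot_ne_zero τ
  have h3 := eulerProd_ne_zero (norm_pow_lt_one (norm_qRoot_lt_one τ) (n := 48) (by norm_num))
  field_simp

theorem sqrt_two_ne_zero : (Real.sqrt 2 : ℂ) ≠ 0 := by
  simp

theorem weberF1_ne_zero (τ : ℍ) : weberF1 τ ≠ 0 := by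
  rw [weberF1_eq]
  have h := norm_qRoot_lt_one τ
  exact div_ne_zero (eulerProd_ne_zero (norm_pow_lt_one h (by norm_num)))
    (mul_ne_zero (qRoot_ne_zero τ) (eulerProd_ne_zero (norm_pow_lt_one h (by norm_num))))

theorem weberF2_ne_zero (τ : ℍ) : weberF2 τ ≠ 0 := by
  rw [weberF2_eq]
  have h := norm_qRoot_lt_one τ
  exact mul_ne_zero sqrt_two_ne_zero (div_ne_zero (mul_ne_zero (pow_ne_zero _ (qRoot_ne_zero τ))
    (eulerProd_ne_zero (norm_pow_lt_one h (by norm_num))))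
    (eulerProd_ne_zero (norm_pow_lt_one h (by norm_num))))

/-- `𝔣 𝔣₁ 𝔣₂ = √2`. -/
theorem weber_mul (τ : ℍ) : weberF τ * weberF1 τ * weberF2 τ = (Real.sqrt 2 : ℂ) := by
  rw [weberF_eq, weberF1_eq, weberF2_eq]
  have h := norm_qRoot_lt_one τ
  have h2 := qRoot_ne_zero τ
  have h3 := eulerProd_ne_zero (norm_pow_lt_one h (n := 48) (by norm_num))
  have h4 := eulerProd_mul_eulerProd_neg (norm_pow_lt_one h (n := 24) (by norm_num))
  rw [← pow_mul, ← pow_mul] at h4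
  norm_num at h4
  field_simp
  linear_combination h4

/-! ### Transformation of the Weber functions under `T` and `S` -/

theorem zeta_48_sq : zeta 48 * zeta 48 = zeta 24 := zeta_sq 24

theorem coe_T_smul (τ : ℍ) : ((ModularGroup.T • τ : ℍ) : ℂ) = τ + 1 := by
  rw [modular_T_smul, coe_vadd]; push_cast; ring

theorem coe_S_smul (τ : ℍ) : ((ModularGroup.S • τ : ℍ) : ℂ) = -1 / τ := by
  rw [modular_S_smul]; simp [neg_div, inv_neg]

theorem weberF_T (τ : ℍ) : weberF (ModularGroup.T • τ) = (zeta 48)⁻¹ * weberF1 τ := by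
  rw [weberF, weberF1, coe_T_smul, show ((τ : ℂ) + 1 + 1) / 2 = τ / 2 + 1 by ring, eta_add_one,
    eta_add_one, mul_div_mul_left _ _ (zeta_ne_zero 24)]

theorem weberF1_T (τ : ℍ) : weberF1 (ModularGroup.T • τ) = (zeta 48)⁻¹ * weberF τ := by
  rw [weberF1, weberF, coe_T_smul, eta_add_one, ← zeta_48_sq]
  have := zeta_ne_zero 48
  field_simp

theorem weberF2_T (τ : ℍ) : weberF2 (ModularGroup.T • τ) = zeta 24 * weberF2 τ := by
  rw [weberF2, weberF2, coe_T_smul, eta_add_one,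
    show 2 * ((τ : ℂ) + 1) = 2 * τ + 1 + 1 by ring, eta_add_one, eta_add_one]
  have := zeta_ne_zero 24
  field_simp

theorem eta_neg_inv {z : ℂ} (hz : 0 < z.im) :
    eta (-1 / z) = (Complex.sqrt Complex.I)⁻¹ * (Complex.sqrt z * eta z) :=
  ModularForm.eta_comp_eq_csqrt_I_inv hz

theorem csqrt_ne_zero {z : ℂ} (hz : z ≠ 0) : Complex.sqrt z ≠ 0 := by
  simp [Complex.sqrt, hz]

/-- A positive real factor does not affect the branch of the logarithm. -/
theorem sqrt_two_mul_csqrt_half {z : ℂ} (hz : z ≠ 0) :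
    (Real.sqrt 2 : ℂ) * Complex.sqrt (z / 2) = Complex.sqrt z := by
  have hz2 : z / 2 ≠ 0 := div_ne_zero hz two_ne_zero
  have hlog := Complex.log_ofReal_mul (r := 2) two_pos hz2
  rw [Complex.ofReal_ofNat, mul_div_cancel₀ z two_ne_zero] at hlog
  rw [Complex.sqrt, Complex.sqrt, Complex.cpow_def_of_ne_zero hz, Complex.cpow_def_of_ne_zero hz2,
    hlog, Real.sqrt_eq_rpow, Real.rpow_def_of_pos two_pos, Complex.ofReal_exp, ← Complex.exp_add]
  congr 1
  push_cast
  ring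

theorem weberF2_S (τ : ℍ) : weberF2 (ModularGroup.S • τ) = weberF1 τ := by
  have h : 0 < ((τ : ℂ) / 2).im := by
    have := τ.im_pos
    simpa using this
  rw [weberF2, weberF1, coe_S_smul, show 2 * (-1 / (τ : ℂ)) = -1 / (τ / 2) by field_simp,
    eta_neg_inv h, eta_neg_inv τ.im_pos, ← sqrt_two_mul_csqrt_half τ.ne_zero]
  have h1 : Complex.sqrt ((τ : ℂ) / 2) ≠ 0 := csqrt_ne_zero (by simpa using τ.ne_zero)
  have h2 := csqrt_ne_zero Complex.I_ne_zero
  have h3 := sqrt_two_ne_zero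
  field_simp

theorem weberF1_S (τ : ℍ) : weberF1 (ModularGroup.S • τ) = weberF2 τ := by
  -- `S` acts on the upper half plane as an involution, so the formula for `𝔣₂` can be inverted.
  rw [← weberF2_S]
  congr 1
  ext
  rw [coe_S_smul, coe_S_smul]
  field_simp

/-- `S` exchanges `𝔣₁` and `𝔣₂`, and the product of all three functions is constant. This avoids
transforming `η((τ+1)/2)` directly. -/
theorem weberF_S (τ : ℍ) : weberF (ModularGroup.S • τ) = weberF τ := by
  have h := weber_mul (ModularGroup.S • τ)
  rw [weberF1_S, weberF2_S, ← weber_mul τ, mul_assoc, mul_assoc, mul_comm (weberF2 τ)] at h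
  exact mul_right_cancel₀ (mul_ne_zero (weberF1_ne_zero τ) (weberF2_ne_zero τ)) h

theorem zeta_pow_div {n r : ℕ} (hn : n ≠ 0) (hr : r ∣ n) : zeta n ^ (n / r) = zeta r := by
  obtain ⟨k, rfl⟩ := hr
  obtain ⟨h1, h2⟩ := mul_ne_zero_iff.mp hn
  have h1' : (r : ℂ) ≠ 0 := Nat.cast_ne_zero.mpr h1
  have h2' : (k : ℂ) ≠ 0 := Nat.cast_ne_zero.mpr h2
  rw [Nat.mul_div_cancel_left _ (Nat.pos_of_ne_zero h1), zeta, zeta, ← Complex.exp_nat_mul]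
  congr 1
  push_cast
  field_simp

theorem weberVec_S (r : ℕ) (τ : ℍ) :
    weberVec r (ModularGroup.S • τ) = varrho r ModularGroup.S (weberVec r τ) := by
  rw [varrho_S, weberVec, weberVec, map_smul, weberF_S, weberF1_S, weberF2_S]
  congr 1
  ext i; fin_cases i <;> simp [varrhoS, Matrix.mulVec, dotProduct, Fin.sum_univ_three]

theorem weberVec_T (r : ℕ) (hr : r ∣ 24) (τ : ℍ) :
    weberVec r (ModularGroup.T • τ) = varrho r ModularGroup.T (weberVec r τ) := by
  have h24 : zeta 24 ^ (24 / r) = zeta r := zeta_pow_div (by norm_num) hr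
  have h48 : zeta 48 ^ (24 / r) = zeta (2 * r) := by
    rw [← zeta_pow_div (n := 48) (r := 2 * r) (by norm_num) (mul_dvd_mul_left 2 hr),
      ← Nat.div_div_eq_div_mul]
  rw [varrho_T, weberVec, weberVec, map_smul, weberF_T, weberF1_T, weberF2_T]
  congr 1
  ext i; fin_cases i <;>
    simp [varrhoT, Matrix.mulVec, dotProduct, Fin.sum_univ_three, mul_pow, h24, h48, mul_comm]

theorem weberVec_smul (r : ℕ) (hr : r ∣ 24) (γ : SL(2, ℤ)) (τ : ℍ) :
    weberVec r (γ • τ) = varrho r γ (weberVec r τ) := by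
  induction γ using SL2Z_induction with
  | h1 => simp
  | hS g ih => rw [mul_smul, weberVec_S, ih, map_mul, Module.End.mul_apply]
  | hT g ih => rw [mul_smul, weberVec_T r hr, ih, map_mul, Module.End.mul_apply]
  | hT' g ih =>
    have h := weberVec_T r hr (ModularGroup.T⁻¹ • g • τ)
    rw [smul_inv_smul, ih] at h
    rw [mul_smul, map_mul, Module.End.mul_apply, h, ← Module.End.mul_apply, ← map_mul,
      inv_mul_cancel, map_one, Module.End.one_apply]

end Weber

/-! ### Expansion at the cusp -/

section Cusp

open Filter Topology

/-- `F_r` as a function of `q^{1/48}`. -/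
def weberExp (r : ℕ) (t : ℂ) : Fin 3 → ℂ :=
  ![((t ^ 2)⁻¹ * (eulerProd (t ^ 48) / eulerProd (t ^ 96))) ^ (24 / r),
    ((Real.sqrt 2 : ℂ) * (t * (eulerProd (t ^ 48) / eulerProd (t ^ 24)))) ^ (24 / r),
    ((Real.sqrt 2 : ℂ) * (t * (eulerProd (t ^ 48) / eulerProd (-t ^ 24)))) ^ (24 / r)]

theorem weberVec_eq (r : ℕ) (τ : ℍ) : weberVec r τ = weberExp r (qRoot τ) := by
  have h3 := sqrt_two_ne_zero
  rw [weberVec, weberExp, weberF_eq, weberF1_eq, weberF2_eq]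
  ext i
  fin_cases i <;>
    simp only [Pi.smul_apply, smul_eq_mul, ← inv_pow, ← mul_pow, Fin.zero_eta, Fin.mk_one,
      Fin.reduceFinMk, Matrix.cons_val] <;> congr 1
  · rw [mul_inv, mul_inv_cancel_left₀ h3, inv_div, ← div_div]
    field_simp
  · rw [inv_div]; ring
  · rw [inv_div]; ring

theorem differentiableAt_weberExp (r : ℕ) {t : ℂ} (h0 : t ≠ 0) (h1 : ‖t‖ < 1) :
    DifferentiableAt ℂ (weberExp r) t := by
  have d : ∀ n : ℕ, n ≠ 0 → DifferentiableAt ℂ (fun t => eulerProd (t ^ n)) t := fun n hn =>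
    (differentiableAt_eulerProd (norm_pow_lt_one h1 hn)).comp t (differentiableAt_pow n)
  have dn : DifferentiableAt ℂ (fun t => eulerProd (-t ^ 24)) t :=
    (differentiableAt_eulerProd (by rw [norm_neg]; exact norm_pow_lt_one h1 (by norm_num))).comp
      t (by fun_prop)
  have n : ∀ n : ℕ, n ≠ 0 → eulerProd (t ^ n) ≠ 0 := fun n hn =>
    eulerProd_ne_zero (norm_pow_lt_one h1 hn)
  have nn : eulerProd (-t ^ 24) ≠ 0 :=
    eulerProd_ne_zero (by rw [norm_neg]; exact norm_pow_lt_one h1 (by norm_num))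
  rw [differentiableAt_pi]
  intro i
  fin_cases i
  · exact (((differentiableAt_id.pow 2).inv (pow_ne_zero 2 h0)).mul
      ((d 48 (by norm_num)).div (d 96 (by norm_num)) (n 96 (by norm_num)))).pow _
  · exact ((differentiableAt_id.mul
      ((d 48 (by norm_num)).div (d 24 (by norm_num)) (n 24 (by norm_num)))).const_mul _).pow _
  · exact ((differentiableAt_id.mul
      ((d 48 (by norm_num)).div dn nn)).const_mul _).pow _

theorem analyticAt_eulerProd_pow {n : ℕ} (hn : n ≠ 0) :
    AnalyticAt ℂ (fun t : ℂ => eulerProd (t ^ n)) 0 :=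
  AnalyticAt.fun_comp (by simpa [hn] using analyticAt_eulerProd_zero) (by fun_prop)

theorem analyticAt_eulerProd_neg_pow :
    AnalyticAt ℂ (fun t : ℂ => eulerProd (-t ^ 24)) 0 :=
  AnalyticAt.fun_comp (by simpa using analyticAt_eulerProd_zero) (by fun_prop)

theorem meromorphicAt_weberExp (r : ℕ) (i : Fin 3) :
    MeromorphicAt (fun t => weberExp r t i) 0 := by
  have a : ∀ n : ℕ, n ≠ 0 → MeromorphicAt (fun t : ℂ => eulerProd (t ^ n)) 0 := fun n hn =>
    (analyticAt_eulerProd_pow hn).meromorphicAt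
  fin_cases i
  · exact (((MeromorphicAt.id 0).pow 2).inv.mul ((a 48 (by norm_num)).div (a 96 (by norm_num)))).pow _
  · exact ((MeromorphicAt.const _ 0).mul ((MeromorphicAt.id 0).mul
      ((a 48 (by norm_num)).div (a 24 (by norm_num))))).pow _
  · exact ((MeromorphicAt.const _ 0).mul ((MeromorphicAt.id 0).mul
      ((a 48 (by norm_num)).div analyticAt_eulerProd_neg_pow.meromorphicAt))).pow _

theorem mdifferentiable_qRoot : MDifferentiable 𝓘(ℂ) 𝓘(ℂ) qRoot := by
  have h : Differentiable ℂ fun z : ℂ => Complex.exp (2 * Real.pi * Complex.I * z / 48) := by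
    fun_prop
  exact h.mdifferentiable.comp mdifferentiable_coe

theorem tendsto_qRoot : Tendsto qRoot atImInfty (𝓝[≠] 0) := by
  rw [tendsto_nhdsWithin_iff]
  refine ⟨?_, Eventually.of_forall qRoot_ne_zero⟩
  have h := UpperHalfPlane.qParam_tendsto_atImInfty (h := 48) (by norm_num)
  refine h.congr fun τ => ?_
  simp [qRoot, Function.Periodic.qParam]

theorem isWeaklyHolomorphic_iota_weberVec (r : ℕ) [NeZero r] (hr : r ∣ 24) :
    IsWeaklyHolomorphic (weilRep r) (fun τ => iota r (weberVec r τ)) where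
  holo := by
    intro τ
    have h1 : DifferentiableAt ℂ (fun t => iota r (weberExp r t)) (qRoot τ) :=
      ((LinearMap.toContinuousLinearMap (iota r)).differentiableAt).comp _
        (differentiableAt_weberExp r (qRoot_ne_zero τ) (norm_qRoot_lt_one τ))
    have h2 := h1.mdifferentiableAt.comp τ (mdifferentiable_qRoot τ)
    simp only [weberVec_eq]
    exact h2
  modular γ τ := by rw [weberVec_smul r hr, iota_varrho r hr]
  cusp := by
    refine ⟨48, by norm_num, fun t => iota r (weberExp r t), ?_, Eventually.of_forall fun τ => ?_⟩
    · have h := fun i => meromorphicAt_weberExp r i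
      have c := fun u : U r => MeromorphicAt.const u (0 : ℂ)
      exact (((h 0).smul (c (vecU r))).add ((h 1).smul (c (vecV r)))).add
        ((h 2).smul (c (vecW r)))
    · simp only [weberVec_eq, qRoot]
      norm_num

/-! ### Principal part and error term -/

theorem exp_eq_qRoot_pow (r : ℕ) [NeZero r] (hr : r ∣ 24) (τ : ℍ) :
    Complex.exp (-(2 * Real.pi * Complex.I * (τ : ℂ)) / r) = ((qRoot τ ^ 2)⁻¹) ^ (24 / r) := by
  obtain ⟨k, hk⟩ := hr
  have h0 := NeZero.pos r
  have h0' : (r : ℂ) ≠ 0 := Nat.cast_ne_zero.mpr h0.ne'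
  have hk' : (24 : ℂ) = r * k := by exact_mod_cast hk
  rw [show 24 / r = k by rw [hk, Nat.mul_div_cancel_left _ h0], qRoot, ← Complex.exp_nat_mul,
    ← Complex.exp_neg, ← Complex.exp_nat_mul]
  congr 1
  push_cast
  field_simp
  linear_combination -2 * (τ : ℂ) * hk'

theorem norm_qRoot_pow (r : ℕ) [NeZero r] (hr : r ∣ 24) (τ : ℍ) :
    ‖qRoot τ‖ ^ (24 / r) = Real.exp (-(2 * Real.pi * τ.im) / (2 * r)) := by
  obtain ⟨k, hk⟩ := hr
  have h0 := NeZero.pos r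
  have h0' : (r : ℝ) ≠ 0 := Nat.cast_ne_zero.mpr h0.ne'
  have hk' : (24 : ℝ) = r * k := by exact_mod_cast hk
  rw [show 24 / r = k by rw [hk, Nat.mul_div_cancel_left _ h0], norm_qRoot, ← Real.exp_nat_mul]
  congr 1
  field_simp
  linear_combination 2 * hk'

/-- With `k = 24/r`, the component is `t^{-2k} Q(t^48)` for a function `Q` differentiable at `0`
with `Q(0) = 1`. The bound on `k` keeps the truncated subtraction in the exponent exact. -/
theorem weberExp_zero_isBigO (r : ℕ) (hr : 24 / r ≤ 24) :
    (fun t => weberExp r t 0 - ((t ^ 2)⁻¹) ^ (24 / r))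
      =O[𝓝[≠] 0] fun t : ℂ => t ^ (48 - 2 * (24 / r)) := by
  generalize hk : 24 / r = k at *
  let Q : ℂ → ℂ := fun x => (eulerProd x / eulerProd (x ^ 2)) ^ k
  have hQ : DifferentiableAt ℂ Q 0 := by
    have h0 : ‖(0 : ℂ)‖ < 1 := by simp
    have h02 : ‖(0 : ℂ) ^ 2‖ < 1 := by simp
    have h2 : DifferentiableAt ℂ (fun x : ℂ => eulerProd (x ^ 2)) 0 :=
      DifferentiableAt.comp (g := eulerProd) (f := fun x : ℂ => x ^ 2) 0
        (differentiableAt_eulerProd h02) (differentiableAt_pow 2)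
    exact ((differentiableAt_eulerProd h0).div h2 (eulerProd_ne_zero h02)).pow _
  have h1 : (fun x => Q x - 1) =O[𝓝 0] fun x : ℂ => x := by
    have := hQ.isBigO_sub
    simpa [Q, eulerProd_zero] using this
  have ht : Tendsto (fun t : ℂ => t ^ 48) (𝓝[≠] 0) (𝓝 0) :=
    (Continuous.tendsto' (by fun_prop) _ _ (by simp)).mono_left nhdsWithin_le_nhds
  have h2 := (Asymptotics.isBigO_refl (fun t : ℂ => ((t ^ 2)⁻¹) ^ k) (𝓝[≠] 0)).mul
    (h1.comp_tendsto ht)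
  refine h2.congr' ?_ ?_
  · filter_upwards with t
    simp only [weberExp, hk, Q, Function.comp_apply, Matrix.cons_val_zero, ← pow_mul]
    rw [mul_pow]; ring
  · filter_upwards [self_mem_nhdsWithin] with t ht
    have ht : t ≠ 0 := ht
    simp only [Function.comp_apply]
    rw [inv_pow, ← pow_mul, inv_mul_eq_iff_eq_mul₀ (pow_ne_zero _ ht), ← pow_add]
    congr 1; omega

/-- Both remaining components are powers of `t` times a quotient bounded near `0`; they differ only
in the denominator `G`. -/
theorem weberExp_isBigO (r : ℕ) {i : Fin 3} (hi : i ≠ 0) :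
    (fun t => weberExp r t i) =O[𝓝[≠] 0] fun t : ℂ => t ^ (24 / r) := by
  have h : ∀ G : ℂ → ℂ, AnalyticAt ℂ G 0 → G 0 ≠ 0 →
      (fun t : ℂ => ((Real.sqrt 2 : ℂ) * (t * (eulerProd (t ^ 48) / G t))) ^ (24 / r))
        =O[𝓝[≠] 0] fun t : ℂ => t ^ (24 / r) := by
    intro G hG h0
    apply Asymptotics.IsBigO.pow
    have hb : (fun t : ℂ => eulerProd (t ^ 48) / G t) =O[𝓝[≠] 0] fun _ => (1 : ℂ) :=
      (((analyticAt_eulerProd_pow (by norm_num)).div hG h0).continuousAt.tendsto.isBigO_one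
        ℂ).mono nhdsWithin_le_nhds
    have h3 := ((Asymptotics.isBigO_refl (fun t : ℂ => t) (𝓝[≠] 0)).mul hb).const_mul_left
      (Real.sqrt 2 : ℂ)
    simpa using h3
  fin_cases i
  · exact absurd rfl hi
  · exact h _ (analyticAt_eulerProd_pow (by norm_num)) (by simp [eulerProd_zero])
  · exact h _ analyticAt_eulerProd_neg_pow (by simp [eulerProd_zero])

/-- `F_r(τ) - q^{-1/r} e₀` is small at the cusp. -/
theorem iota_weberVec_sub_isBigO (r : ℕ) [NeZero r] (hr : r ∣ 24) (n : ℕ) (hn : n ≤ 24 / r)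
    (hn' : n ≤ 48 - 2 * (24 / r)) :
    (fun τ : ℍ => iota r (weberVec r τ) -
        Complex.exp (-(2 * Real.pi * Complex.I * (τ : ℂ)) / r) • vecU r)
      =O[atImInfty] fun τ => ‖qRoot τ‖ ^ n := by
  have hle : ∀ m : ℕ, n ≤ m → (fun t : ℂ => t ^ m) =O[𝓝[≠] 0] fun t : ℂ => t ^ n := by
    intro m hm
    refine Asymptotics.IsBigO.of_bound 1 ?_
    have : Metric.ball (0 : ℂ) 1 ∈ 𝓝[≠] (0 : ℂ) :=
      nhdsWithin_le_nhds (Metric.ball_mem_nhds _ one_pos)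
    filter_upwards [this] with t ht
    rw [norm_pow, norm_pow, one_mul]
    exact pow_le_pow_of_le_one (norm_nonneg t) (by simpa using (mem_ball_zero_iff.mp ht).le) hm
  have hs : ∀ (f : ℂ → ℂ) (u : U r), (f =O[𝓝[≠] 0] fun t : ℂ => t ^ n) →
      (fun t => f t • u) =O[𝓝[≠] 0] fun t : ℂ => t ^ n := by
    intro f u hf
    have := hf.smul (Asymptotics.isBigO_refl (fun _ : ℂ => u) (𝓝[≠] 0))
    exact this.trans (Asymptotics.IsBigO.of_bound ‖u‖ (Eventually.of_forall fun t => by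
      rw [norm_smul, mul_comm]))
  have h := ((hs _ (vecU r) ((weberExp_zero_isBigO r (Nat.div_le_self _ _)).trans
    (hle _ hn'))).add (hs _ (vecV r) ((weberExp_isBigO r (i := 1) (by decide)).trans
    (hle _ hn)))).add (hs _ (vecW r) ((weberExp_isBigO r (i := 2) (by decide)).trans (hle _ hn)))
  have h2 := (h.comp_tendsto tendsto_qRoot).norm_right
  refine h2.congr (fun τ => ?_) (fun τ => by simp)
  rw [weberVec_eq, exp_eq_qRoot_pow r hr, iota_apply]
  simp only [Function.comp_apply, sub_smul]
  abel

end Cusp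
end WeberWeil

end

open WeberWeil
theorem proposition3p4 (r : ℕ) [NeZero r] (hr : r ∣ 24) :
    (Function.Injective (iota r) ∧
      (∀ x : Fin 3 → ℂ, iota r x ∈ invariants r) ∧
      (∀ (γ : Matrix.SpecialLinearGroup (Fin 2) ℤ) (x : Fin 3 → ℂ),
        iota r (varrho r γ x) = weilRep r γ (iota r x))) ∧
    IsWeaklyHolomorphic (weilRep r) (fun τ => iota r (weberVec r τ)) ∧
    (∀ τ : UpperHalfPlane, iota r (weberVec r τ) ∈ invariants r) ∧
    (r = 1 → (fun τ : UpperHalfPlane => iota r (weberVec r τ) -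
        Complex.exp (-(2 * Real.pi * Complex.I * (τ : ℂ)) / r) • vecU r)
      =O[UpperHalfPlane.atImInfty] fun _ => (1 : ℝ)) ∧
    (1 < r → (fun τ : UpperHalfPlane => iota r (weberVec r τ) -
        Complex.exp (-(2 * Real.pi * Complex.I * (τ : ℂ)) / r) • vecU r)
      =O[UpperHalfPlane.atImInfty] fun τ => Real.exp (-(2 * Real.pi * τ.im) / (2 * r))) := by
  refine ⟨⟨iota_injective r hr, iota_mem_invariants r, iota_varrho r hr⟩,
    isWeaklyHolomorphic_iota_weberVec r hr, fun τ => iota_mem_invariants r _, fun h => ?_,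
    fun h => ?_⟩
  -- For `r = 1` the first component has error exponent `48 - 2 · 24 = 0`, so no decay is available.
  · have h1 := iota_weberVec_sub_isBigO r hr 0 (Nat.zero_le _) (Nat.zero_le _)
    simpa only [pow_zero] using h1
  -- For `k = 24/r ≤ 12` one has `48 - 2k ≥ k`, so the error is governed by `t^k = q^{1/2r}`, coming
  -- from `𝔣₁` and `𝔣`.
  · have h12 : 24 / r ≤ 12 := (Nat.div_le_div_left h two_pos).trans (by norm_num)
    have h1 := iota_weberVec_sub_isBigO r hr (24 / r) le_rfl (by omega)
    simpa only [norm_qRoot_pow r hr] using h1
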